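/- Let $K$ be a field of characteristic $0$. Let $V=K[h(-1),h(-2),h(-3),\dots]$ be the rank one Heisenberg vertex operator algebra at level one, with vacuum $\mathbf 1=1$: for $n\ge 1$ the operator $h(-n)$ acts by multiplication and $h(n)$ by $n\,\partial/\partial h(-n)$, and $h(0)=0$. Its central charge is $1$. The vertex operators are $Y(\mathbf 1,z)=\mathrm{id}$ and $Y(h(-n_1-1)\cdots h(-n_k-1)\mathbf 1,z)={:}\partial^{(n_1)}h(z)\cdots\partial^{(n_k)}h(z){:}$ for $n_i\ge 0$, where $h(z)=\sum_{n\in\mathbb Z}h(n)z^{-n-1}$, $\partial^{(m)}=\frac1{m!}\frac{d^m}{dz^m}$ and ${:}\ {:}$ is normal ordering. Write $Y(a,z)=\sum_{n\in\mathbb Z}a(n)z^{-n-1}$. Grade $V=\bigoplus_{n\ge 0}V_{(n)}$ by giving $h(-n)$ weight $n$. The zero mode of $a\in V_{(k)}$ is $o(a)=a(k-1)$, and $o$ is extended additively to $V$. The rescaled character of $a\in V$ is $$\boldsymbol f(a)=\eta(q)\,Z(a,q),\qquad Z(a,q)=q^{-1/24}\sum_{n\ge 0}\operatorname{Tr}_{V_{(n)}}o(a)\,q^n,\qquad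 \eta(q)=q^{1/24}\prod_{m\ge 1}(1-q^m).$$ The square-bracket modes are the operators $h[n]$ on $V$ given by $Y(h(-1)\mathbf 1,e^z-1)\,e^z=\sum_{n\in\mathbb Z}h[n]z^{-n-1}$, that is, $h[n]=\operatorname{Res}_z Y(h(-1)\mathbf 1,e^z-1)\,e^z z^n$. For even $k\ge 2$ let $$G_k(q)=-\frac{B_k}{2k}+\sum_{n\ge 1}\sigma_{k-1}(n)q^n .$$ **Proposition.** For all odd integers $r,t\ge 1$, $$\boldsymbol f\bigl(h[-r]\,h[-1]^t\,\mathbf 1\bigr)=\frac{2^{(t+1)/2}\,t\,(t-2)!!}{(r-1)!}\;G_2(q)^{(t-1)/2}\,G_{r+1}(q),$$ as formal series in $q$ over $K$. Here, for odd $n$, $n!!$ is the product of all positive odd integers not exceeding $n$; in particular $(-1)!!=1$. -/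

import Mathlib

open scoped VertexOperator Nat

noncomputable section

namespace Heisenberg

/-! ### The Fock space -/

/-- The Fock space `K[h(-1), h(-2), h(-3), …]` of the rank one Heisenberg algebra at level one. The
variable `X j` is the creation operator `h(-j-1)`, and `1` is the vacuum vector. -/
abbrev Fock (K : Type*) [Field K] : Type _ := MvPolynomial ℕ K

/-- The conformal weight of `h(-j-1)` is `j + 1`. -/
def wt (j : ℕ) : ℕ := j + 1

/-- The weight space `V_(n)` of the Fock space. -/
abbrev weightSpace (K : Type*) [Field K] (n : ℕ) : Submodule K (Fock K) :=
  MvPolynomial.weightedHomogeneousSubmodule K wt n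

/-! ### The vertex operators -/

/-- The total differential `b ↦ (∂b/∂h(-j-1))_j`. -/
def totalDiff (K : Type*) [Field K] : Fock K →ₗ[K] (ℕ →₀ Fock K) :=
  (MvPolynomial.mkDerivation K (fun j : ℕ => Finsupp.single j (1 : Fock K))).toLinearMap

/-- Multiplication by an element of the ring `V((z))`. -/
def mulOp {K : Type*} [Field K] (x : LaurentSeries (Fock K)) :
    LaurentSeries (Fock K) →ₗ[K] LaurentSeries (Fock K) where
  toFun y := x * y
  map_add' := mul_add x
  map_smul' c y := by
    have key : ∀ y : LaurentSeries (Fock K),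
        c • y = HahnSeries.C (MvPolynomial.C c : Fock K) * y := by
      intro y
      refine HahnSeries.ext (funext fun n => ?_)
      rw [HahnSeries.C_mul_eq_smul, HahnSeries.coeff_smul, HahnSeries.coeff_smul, smul_eq_mul,
        MvPolynomial.C_mul']
    rw [RingHom.id_apply, key, key, mul_left_comm]

/-- The creation part `∑_{i ≥ 0} binom(i+n, n) h(-i-n-1) z^i` of the field
`∂^(n) h(z) = (1/n!) (d/dz)^n h(z)`, where `h(z) = ∑_{k ∈ ℤ} h(k) z^(-k-1)`. -/
def creation (K : Type*) [Field K] (n : ℕ) : LaurentSeries (Fock K) :=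
  HahnSeries.ofPowerSeries ℤ (Fock K)
    (PowerSeries.mk fun i => ((i + n).choose n : Fock K) * MvPolynomial.X (i + n))

/-- The scalar `binom(-j-2, n) (j+1) z^(-j-2-n)`, where
`binom(-j-2, n) = (-1)^n binom(j+n+1, n)`. -/
def annCoeff (K : Type*) [Field K] (n j : ℕ) : LaurentSeries (Fock K) :=
  HahnSeries.single (-(j : ℤ) - 2 - n)
    (MvPolynomial.C ((-1 : K) ^ n * ((j + n + 1).choose n : K) * ((j : K) + 1)))

/-- The operator `A(z)` composed with the annihilation part
`∑_{j ≥ 0} binom(-j-2, n) z^(-j-2-n) h(j+1)` of the field `∂^(n) h(z)` on its right. Here `h(j+1)`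
acts as `(j+1) ∂/∂h(-j-1)`, and the operator `h(0)` is zero. -/
def compAnnihilation {K : Type*} [Field K] (n : ℕ) (A : Fock K →ₗ[K] LaurentSeries (Fock K)) :
    Fock K →ₗ[K] LaurentSeries (Fock K) :=
  (Finsupp.lsum K fun j : ℕ =>
    mulOp (annCoeff K n j) ∘ₗ A)
  ∘ₗ totalDiff K

/-- The normally ordered product `: ∂^(n) h(z) A(z) :`, in which the creation part of `∂^(n) h(z)`
stands to the left of `A(z)` and the annihilation part to the right. -/
def normalOrder {K : Type*} [Field K] (n : ℕ) (A : Fock K →ₗ[K] LaurentSeries (Fock K)) :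
    Fock K →ₗ[K] LaurentSeries (Fock K) :=
  mulOp (creation K n) ∘ₗ A + compAnnihilation n A

theorem totalDiff_apply {K : Type*} [Field K] (b : Fock K) (j : ℕ) :
    totalDiff K b j = MvPolynomial.pderiv j b := by
  classical
  induction b using MvPolynomial.induction_on with
  | C a =>
    simp [totalDiff]
  | add p q hp hq => rw [map_add, map_add, Finsupp.add_apply, hp, hq]
  | mul_X p i hp =>
    have h : totalDiff K (p * MvPolynomial.X i) =
        p • Finsupp.single i (1 : Fock K) + (MvPolynomial.X i : Fock K) • totalDiff K p := by
      simp [totalDiff]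
    rw [h, Derivation.leibniz, Finsupp.add_apply, Finsupp.smul_apply, Finsupp.smul_apply, hp,
      MvPolynomial.pderiv_X, Finsupp.single_apply, Pi.single_apply]

theorem normalOrder_apply {K : Type*} [Field K] (n : ℕ)
    (A : Fock K →ₗ[K] LaurentSeries (Fock K)) (b : Fock K) (s : Finset ℕ)
    (hs : (totalDiff K b).support ⊆ s) :
    normalOrder n A b = creation K n * A b +
      ∑ j ∈ s, annCoeff K n j * A (MvPolynomial.pderiv j b) := by
  have h : compAnnihilation n A b = ∑ j ∈ s, annCoeff K n j * A (MvPolynomial.pderiv j b) := by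
    simp only [compAnnihilation, LinearMap.comp_apply, Finsupp.lsum_apply]
    rw [Finsupp.sum_of_support_subset _ hs _ (by simp)]
    simp [mulOp, totalDiff_apply]
  rw [← h]
  rfl

theorem pderiv_comm {K : Type*} [Field K] (b : Fock K) (i j : ℕ) :
    MvPolynomial.pderiv i (MvPolynomial.pderiv j b) =
      MvPolynomial.pderiv j (MvPolynomial.pderiv i b) := by
  classical
  have h : ⁅(MvPolynomial.pderiv i : Derivation K (Fock K) (Fock K)),
      (MvPolynomial.pderiv j : Derivation K (Fock K) (Fock K))⁆ = 0 := by
    refine MvPolynomial.derivation_ext fun k => ?_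
    rw [Derivation.commutator_apply, MvPolynomial.pderiv_X, MvPolynomial.pderiv_X]
    rw [Pi.single_apply, Pi.single_apply]
    split_ifs <;> simp
  have h3 := congrArg (fun D : Derivation K (Fock K) (Fock K) => D b) h
  simp only [Derivation.commutator_apply, Derivation.zero_apply] at h3
  exact sub_eq_zero.mp h3

theorem support_pderiv {K : Type*} [Field K] (b : Fock K) (i : ℕ) :
    (totalDiff K (MvPolynomial.pderiv i b)).support ⊆ (totalDiff K b).support := by
  intro j hj
  rw [Finsupp.mem_support_iff, totalDiff_apply] at hj ⊢
  intro h
  apply hj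
  rw [pderiv_comm, h, map_zero]

/-- Normally ordered products do not depend on the order of the factors. -/
theorem normalOrder_comm {K : Type*} [Field K] (m n : ℕ)
    (A : Fock K →ₗ[K] LaurentSeries (Fock K)) :
    normalOrder m (normalOrder n A) = normalOrder n (normalOrder m A) := by
  refine LinearMap.ext fun b => ?_
  have h := fun (n : ℕ) (A : Fock K →ₗ[K] LaurentSeries (Fock K)) =>
    normalOrder_apply n A b _ subset_rfl
  have h' := fun (n : ℕ) (A : Fock K →ₗ[K] LaurentSeries (Fock K)) (i : ℕ) =>
    normalOrder_apply n A (MvPolynomial.pderiv i b) _ (support_pderiv b i)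
  rw [h, h, h, h]
  simp only [h']
  generalize (totalDiff K b).support = S
  generalize creation K m = cm, creation K n = cn
  generalize annCoeff K m = tm, annCoeff K n = tn
  have e2 : ∑ i ∈ S, tm i * ∑ j ∈ S, tn j * A (MvPolynomial.pderiv j (MvPolynomial.pderiv i b)) =
      ∑ i ∈ S, tn i * ∑ j ∈ S, tm j * A (MvPolynomial.pderiv j (MvPolynomial.pderiv i b)) := by
    simp only [Finset.mul_sum]
    rw [Finset.sum_comm]
    refine Finset.sum_congr rfl fun i _ => Finset.sum_congr rfl fun j _ => ?_
    rw [mul_left_comm, pderiv_comm]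
  have e3 : ∀ (c : LaurentSeries (Fock K)) (t : ℕ → LaurentSeries (Fock K)),
      ∑ i ∈ S, t i * (c * A (MvPolynomial.pderiv i b)) =
        c * ∑ i ∈ S, t i * A (MvPolynomial.pderiv i b) := by
    intro c t
    rw [Finset.mul_sum]
    exact Finset.sum_congr rfl fun i _ => mul_left_comm _ _ _
  simp only [mul_add, Finset.sum_add_distrib, e2, e3]
  rw [mul_left_comm cm cn]
  abel

instance instLeftCommutative {K : Type*} [Field K] :
    LeftCommutative (normalOrder (K := K)) := ⟨normalOrder_comm⟩

/-- A linear map `V → V((z))` as a vertex operator. -/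
def toVertexOperator {K : Type*} [Field K] (A : Fock K →ₗ[K] LaurentSeries (Fock K)) :
    VertexOperator K (Fock K) where
  toFun b := HahnModule.of K (A b)
  map_add' _ _ := by rw [map_add, HahnModule.of_add]
  map_smul' _ _ := by rw [map_smul]; rfl

/-- The state-field correspondence `a ↦ Y(a, z)`. It is the linear map sending the monomial
`h(-n₁-1) ⋯ h(-nₖ-1) 1` to `: ∂^(n₁) h(z) ⋯ ∂^(nₖ) h(z) :`, where the empty product is the
inclusion `V ⊆ V((z))`. The mode `a(n)`, the coefficient of `z^(-n-1)` in `Y(a, z)`, is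
`(Y K a)[[n]]`. -/
def Y (K : Type*) [Field K] : Fock K →ₗ[K] VertexOperator K (Fock K) :=
  (MvPolynomial.basisMonomials ℕ K).constr K fun s =>
    toVertexOperator
      ((Finsupp.toMultiset s).foldr normalOrder (HahnSeries.single.linearMap (0 : ℤ)))

/-! ### Zero modes and the character -/

/-- All coefficients of the Laurent series are homogeneous, the one of `z^e` of weight `d + e`. -/
def HasDegree {K : Type*} [Field K] (d : ℤ) (x : LaurentSeries (Fock K)) : Prop :=
  ∀ (e : ℤ) (s : ℕ →₀ ℕ), MvPolynomial.coeff s (x.coeff e) ≠ 0 → (Finsupp.weight wt s : ℤ) = d + e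

theorem HasDegree.zero {K : Type*} [Field K] (d : ℤ) : HasDegree d (0 : LaurentSeries (Fock K)) := by
  intro e s h
  simp at h

theorem HasDegree.add {K : Type*} [Field K] {d : ℤ} {x y : LaurentSeries (Fock K)}
    (hx : HasDegree d x) (hy : HasDegree d y) : HasDegree d (x + y) := by
  intro e s h
  rw [HahnSeries.coeff_add, MvPolynomial.coeff_add] at h
  by_cases h1 : MvPolynomial.coeff s (x.coeff e) = 0
  · exact hy e s fun h2 => h (by rw [h1, h2, add_zero])
  · exact hx e s h1

theorem HasDegree.sum {K : Type*} [Field K] {ι : Type*} {d : ℤ} {x : ι → LaurentSeries (Fock K)}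
    (t : Finset ι) (hx : ∀ i ∈ t, HasDegree d (x i)) : HasDegree d (∑ i ∈ t, x i) :=
  Finset.sum_induction x (HasDegree d) (fun _ _ => HasDegree.add) (HasDegree.zero d) hx

theorem HasDegree.mul {K : Type*} [Field K] {c d : ℤ} {x y : LaurentSeries (Fock K)}
    (hx : HasDegree c x) (hy : HasDegree d y) : HasDegree (c + d) (x * y) := by
  classical
  intro e s h
  rw [HahnSeries.coeff_mul, MvPolynomial.coeff_sum] at h
  obtain ⟨p, hp, h⟩ := Finset.exists_ne_zero_of_sum_ne_zero h
  rw [MvPolynomial.coeff_mul] at h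
  obtain ⟨q, hq, h⟩ := Finset.exists_ne_zero_of_sum_ne_zero h
  have h1 := hx _ _ (left_ne_zero_of_mul h)
  have h2 := hy _ _ (right_ne_zero_of_mul h)
  rw [Finset.HasAntidiagonal.mem_antidiagonal] at hq
  have h3 := (Finset.mem_antidiagonal.mp hp).2.2
  rw [← hq, map_add, Nat.cast_add, h1, h2, ← h3]
  ring

theorem HasDegree.creation {K : Type*} [Field K] (n : ℕ) :
    HasDegree (n + 1) (creation K n) := by
  classical
  intro e s h
  rw [Heisenberg.creation, PowerSeries.coeff_coe] at h
  split_ifs at h with he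
  · simp at h
  · rw [PowerSeries.coeff_mk, ← map_natCast (MvPolynomial.C (R := K) (σ := ℕ)),
      MvPolynomial.coeff_C_mul, MvPolynomial.coeff_X] at h
    have h1 : Finsupp.single (e.natAbs + n) 1 = s := by
      by_contra h2
      exact h (by rw [if_neg h2, mul_zero])
    rw [← h1, Finsupp.weight_single]
    simp only [wt, smul_eq_mul, one_mul]
    lia

theorem HasDegree.annCoeff {K : Type*} [Field K] (n j : ℕ) :
    HasDegree (n + j + 2) (annCoeff K n j) := by
  classical
  intro e s h
  rw [Heisenberg.annCoeff, HahnSeries.coeff_single] at h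
  split_ifs at h with he
  · rw [MvPolynomial.coeff_C] at h
    split_ifs at h with hs
    · rw [← hs, he, map_zero]
      push_cast
      ring
    · exact absurd rfl h
  · simp at h

theorem HasDegree.normalOrder {K : Type*} [Field K] {d : ℤ} (n : ℕ)
    {A : Fock K →ₗ[K] LaurentSeries (Fock K)}
    (hA : ∀ (k : ℕ) (b : Fock K), b ∈ weightSpace K k → HasDegree (d + k) (A b))
    (k : ℕ) (b : Fock K) (hb : b ∈ weightSpace K k) :
    HasDegree (n + 1 + d + k) (normalOrder n A b) := by
  rw [normalOrder_apply n A b _ subset_rfl]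
  refine HasDegree.add ?_ (HasDegree.sum _ fun j _ => ?_)
  · have := (HasDegree.creation (K := K) n).mul (hA k b hb)
    rwa [← add_assoc] at this
  · by_cases hk : j + 1 ≤ k
    · have h1 : MvPolynomial.pderiv j b ∈ weightSpace K (k - (j + 1)) :=
        MvPolynomial.IsWeightedHomogeneous.pderiv hb (by simp only [wt]; lia)
      have h2 := (HasDegree.annCoeff (K := K) n j).mul (hA _ _ h1)
      have h3 : (n + j + 2 + (d + (k - (j + 1) : ℕ)) : ℤ) = n + 1 + d + k := by lia
      rwa [h3] at h2
    · have h1 : MvPolynomial.pderiv j b = 0 := by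
        refine MvPolynomial.pderiv_eq_zero_of_notMem_vars fun hj => hk ?_
        obtain ⟨s, hs, hjs⟩ := (MvPolynomial.mem_vars_iff_mem_support j).mp hj
        have h2 : Finsupp.weight wt s = k := hb (MvPolynomial.mem_support_iff.mp hs)
        rw [← h2]
        exact Finsupp.le_weight_of_ne_zero' wt (Finsupp.mem_support_iff.mp hjs)
      rw [h1, map_zero, mul_zero]
      exact HasDegree.zero _

theorem HasDegree.foldr {K : Type*} [Field K] (s : Multiset ℕ) (k : ℕ) (b : Fock K)
    (hb : b ∈ weightSpace K k) :
    HasDegree ((s.map wt).sum + k)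
      (s.foldr Heisenberg.normalOrder (HahnSeries.single.linearMap (0 : ℤ)) b) := by
  induction s using Multiset.induction_on generalizing k b with
  | empty =>
    intro e s h
    rw [Multiset.foldr_zero] at h
    change MvPolynomial.coeff s ((HahnSeries.single (0 : ℤ) b).coeff e) ≠ 0 at h
    rw [HahnSeries.coeff_single] at h
    split_ifs at h with he
    · rw [hb h, he]
      simp
    · simp at h
  | cons n s ih =>
    rw [Multiset.foldr_cons]
    have h := HasDegree.normalOrder n ih k b hb
    simp only [Multiset.map_cons, Multiset.sum_cons, wt]
    push_cast at h ⊢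
    exact h

theorem sum_map_wt (s : ℕ →₀ ℕ) :
    ((Finsupp.toMultiset s).map wt).sum = Finsupp.weight wt s := by
  induction s using Finsupp.induction_linear with
  | zero => simp
  | add f g hf hg => rw [map_add, Multiset.map_add, Multiset.sum_add, hf, hg, map_add]
  | single i n => simp [Finsupp.toMultiset_single, Finsupp.weight_single, Multiset.map_nsmul,
    Multiset.sum_nsmul]

theorem Y_hasDegree {K : Type*} [Field K] (m k : ℕ) (a b : Fock K) (ha : a ∈ weightSpace K m)
    (hb : b ∈ weightSpace K k) : HasDegree (m + k) ((HahnModule.of K).symm (Y K a b)) := by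
  have h : (HahnModule.of K).symm (Y K a b) = ∑ s ∈ a.support, a.coeff s •
      (Finsupp.toMultiset s).foldr normalOrder (HahnSeries.single.linearMap (0 : ℤ)) b := by
    have h1 : Y K a = ∑ s ∈ a.support, a.coeff s • toVertexOperator
        ((Finsupp.toMultiset s).foldr normalOrder (HahnSeries.single.linearMap (0 : ℤ))) := by
      rw [Y, Module.Basis.constr_apply]
      rfl
    rw [h1, LinearMap.sum_apply]
    rfl
  rw [h]
  refine HasDegree.sum _ fun s hs => ?_
  have h1 := HasDegree.foldr (Finsupp.toMultiset s) k b hb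
  have h2 : ((Finsupp.toMultiset s).map wt).sum = m := by
    rw [← ha (MvPolynomial.mem_support_iff.mp hs), sum_map_wt]
  rw [h2] at h1
  intro e d hd
  rw [HahnSeries.coeff_smul, MvPolynomial.coeff_smul] at hd
  exact h1 e d (right_ne_zero_of_mul hd)

/-- The zero mode `o(a)` of a state `a`: it is `a(k-1)` for `a` of weight `k`, extended
additively. -/
def zeroMode {K : Type*} [Field K] (a : Fock K) : Module.End K (Fock K) :=
  ∑ᶠ k : ℕ, (Y K (MvPolynomial.weightedHomogeneousComponent wt k a))[[(k : ℤ) - 1]]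

/-- The zero mode preserves every weight space. -/
theorem zeroMode_mem {K : Type*} [Field K] (a : Fock K) (n : ℕ) :
    ∀ b ∈ weightSpace K n, zeroMode a b ∈ weightSpace K n := by
  have h : zeroMode a ∈ Submodule.compatibleMaps (weightSpace K n) (weightSpace K n) := by
    refine finsum_induction
      (fun f => f ∈ Submodule.compatibleMaps (weightSpace K n) (weightSpace K n))
      (Submodule.zero_mem _) (fun _ _ => Submodule.add_mem _) fun k c hc s hs => ?_
    have := Y_hasDegree k n _ c (MvPolynomial.weightedHomogeneousComponent_mem wt a k) hc _ s hs
    lia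
  exact fun b hb => h hb

/-- The character `Z(a, q) = q^(-c/24) ∑_n Tr_{V_(n)} o(a) q^n`, where `c = 1`, as a formal series
in rational powers of `q`. -/
def character {K : Type*} [Field K] (a : Fock K) : HahnSeries ℚ K :=
  HahnSeries.single (-1 / 24 : ℚ) 1 * HahnSeries.ofPowerSeries ℚ K
    (PowerSeries.mk fun n =>
      LinearMap.trace K (weightSpace K n) ((zeroMode a).restrict (zeroMode_mem a n)))

/-- The eta function `η(q) = q^(1/24) ∏_{m ≥ 1} (1 - q^m)`. Only the factors with `m ≤ n` contribute
to the coefficient of `q^n` in the product. -/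
def eta (K : Type*) [Field K] : HahnSeries ℚ K :=
  HahnSeries.single (1 / 24 : ℚ) 1 * HahnSeries.ofPowerSeries ℚ K
    (PowerSeries.mk fun n => PowerSeries.coeff n (∏ m ∈ Finset.Icc 1 n, (1 - PowerSeries.X ^ m)))

/-- The rescaled character `f(a) = η(q) Z(a, q)`. -/
def rescaledCharacter {K : Type*} [Field K] (a : Fock K) : HahnSeries ℚ K :=
  eta K * character a

/-! ### Square-bracket modes -/

/-- The series `e^z` in `K((z))`. -/
def expSeries (K : Type*) [Field K] [CharZero K] : LaurentSeries K :=
  HahnSeries.ofPowerSeries ℤ K (PowerSeries.exp K)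

/-- The square-bracket mode
`h[n] = Res_z Y(h(-1)1, e^z - 1) e^z z^n = ∑_m Res_z ((e^z - 1)^(-m-1) e^z z^n) h(m)`,
where the residue is the coefficient of `z^(-1)`. The residue vanishes for `m < n`, and `h(m) b`
vanishes for large `m`, so that the sum is finite on every state `b`. -/
def squareMode {K : Type*} [Field K] [CharZero K] (n : ℤ) (b : Fock K) : Fock K :=
  ∑ᶠ m : ℤ, ((expSeries K - 1) ^ (-m - 1) * expSeries K * HahnSeries.single n 1).coeff (-1) •
    ((Y K (MvPolynomial.X 0))[[m]]) b

/-! ### Eisenstein series -/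

/-- The `q`-expansion `G_k = -B_k/(2k) + ∑_{n ≥ 1} σ_{k-1}(n) q^n`. -/
def eisenstein (K : Type*) [Field K] [CharZero K] (k : ℕ) : PowerSeries K :=
  PowerSeries.mk fun n =>
    if n = 0 then -(bernoulli k : K) / (2 * k) else (ArithmeticFunction.sigma (k - 1) n : K)

end Heisenberg

end

/-!
Write `E(a) = ∏ (1 - q^m) ∑_n Tr_{V_(n)} o(a) q^n`; this is the rescaled character of `a`. The proof
treats `E` as a Gaussian expectation on the polynomials in `h(-1), h(-2), …`.

*Normalization.* `E(1) = 1` (`eulerProd_mul_dim`): the graded dimension `D` and the product have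
opposite logarithmic derivatives. For `D` this is Euler's identity `∑_j h(-j) h(j) = n` on `V_(n)`
combined with the traces of its summands.

*Integration by parts.* By cyclicity, if `g` raises the weight by `k > 0` and `f` lowers it by `k`,
the traces of `g f` are `q^k / (1 - q^k)` times those of the commutator `[f, g]`
(`gradedTrace_comp`). A normally ordered product has its creation operators on the left and its
annihilation operators on the right, and the commutator of either with `: h(z)^k :` is `k` times a
scalar times `: h(z)^(k-1) :` (`fieldPow_X_mul`, `coeffDeriv_fieldPow`). This gives
`E(h(-m-1) p(h(-1))) = g_m E(p'(h(-1)))` for each polynomial `p`, with `g_m` the Lambert series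
`contraction K m` (`expectation_X_mul_aeval`).

*Square brackets.* On polynomials in `h(-1)`, the mode `h[-r]` is multiplication by a linear form in
the `h(-i)` plus a multiple of `d/dh(-1)`. The coefficients of the form are such that binomial
expansion of the powers `(e^z - 1 + 1)^n` turns the resulting combination of the `g_m` into
`2/(r-1)! ∑_n σ_r(n) q^n` when `r` is odd, and the coefficient of `d/dh(-1)`, a Bernoulli number, is
the missing constant term of `2/(r-1)! G_(r+1)`. So
`E(h[-r] p(h(-1))) = 2/(r-1)! G_(r+1) E(p'(h(-1)))` (`expectation_squareMode`).

*Conclusion.* The polynomials `p_t` with `p_t(h(-1)) = h[-1]^t 1` satisfy `p_t' = t p_(t-1)`, hence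
`E(p_t) = 2 G_2 (t-1) E(p_(t-2))`.
-/

noncomputable section

namespace Heisenberg

variable {K : Type*} [Field K]

/-! ### Graded traces -/

theorem finite_weight_eq (n : ℕ) : {s : ℕ →₀ ℕ | Finsupp.weight wt s = n}.Finite := by
  refine (Set.finite_Iic (∑ j ∈ Finset.range n, Finsupp.single j n)).subset fun s hs j => ?_
  have hs : Finsupp.weight wt s = n := hs
  by_cases hj : s j = 0
  · rw [hj]
    exact Nat.zero_le _
  have h1 : (j + 1) ≤ n := hs ▸ Finsupp.le_weight_of_ne_zero' wt hj
  have h2 : s j ≤ n := hs ▸ Finsupp.le_weight wt (Nat.succ_ne_zero j) s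
  rw [Finsupp.finsetSum_apply,
    Finset.sum_eq_single j (fun i _ hi => Finsupp.single_eq_of_ne hi.symm)
    (fun h => absurd (Finset.mem_range.mpr h1) h), Finsupp.single_eq_same]
  exact h2

instance finite_weightSpace (n : ℕ) : Module.Finite K (weightSpace K n) := by
  have := (finite_weight_eq n).to_subtype
  rw [weightSpace, MvPolynomial.weightedHomogeneousSubmodule_eq_finsupp_supported]
  exact Module.Finite.of_basis
    (MvPolynomial.basisRestrictSupport K {d | Finsupp.weight wt d = n})

/-- The projection of the Fock space onto its weight space `V_(n)`. -/
def weightProj (K : Type*) [Field K] (n : ℕ) : Fock K →ₗ[K] weightSpace K n :=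
  (MvPolynomial.weightedHomogeneousComponent wt n).codRestrict _
    fun a => MvPolynomial.weightedHomogeneousComponent_mem wt a n

theorem weightProj_of_mem {n : ℕ} {b : Fock K} (hb : b ∈ weightSpace K n) :
    (weightProj K n b : Fock K) = b :=
  MvPolynomial.IsWeightedHomogeneous.weightedHomogeneousComponent_same hb

/-- The compression of an operator on the Fock space to the weight space `V_(n)`. -/
def compress (n : ℕ) : Module.End K (Fock K) →ₗ[K] Module.End K (weightSpace K n) where
  toFun f := weightProj K n ∘ₗ f ∘ₗ (weightSpace K n).subtype
  map_add' f g := by rw [LinearMap.add_comp, LinearMap.comp_add]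
  map_smul' c f := by rw [LinearMap.smul_comp, LinearMap.comp_smul, RingHom.id_apply]

theorem compress_congr {n : ℕ} {f g : Module.End K (Fock K)}
    (h : ∀ b ∈ weightSpace K n, f b = g b) : compress n f = compress n g :=
  LinearMap.ext fun b => congrArg (weightProj K n) (h b b.2)

/-- The series `∑_n Tr_{V_(n)}(f) q^n`, where the trace on `V_(n)` is that of the compression of
`f`. -/
def gradedTrace (K : Type*) [Field K] : Module.End K (Fock K) →ₗ[K] PowerSeries K where
  toFun f := PowerSeries.mk fun n => LinearMap.trace K (weightSpace K n) (compress n f)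
  map_add' f g := by ext n; simp
  map_smul' c f := by ext n; simp

theorem coeff_gradedTrace (n : ℕ) (f : Module.End K (Fock K)) :
    PowerSeries.coeff n (gradedTrace K f) =
      LinearMap.trace K (weightSpace K n) (compress n f) := by
  simp [gradedTrace]

/-- An operator that raises the weight by `d`. -/
def ShiftsWeight (d : ℤ) (f : Module.End K (Fock K)) : Prop :=
  ∀ (n : ℕ) (b : Fock K), b ∈ weightSpace K n →
    ∀ s, MvPolynomial.coeff s (f b) ≠ 0 → (Finsupp.weight wt s : ℤ) = n + d

theorem ShiftsWeight.mem {d : ℤ} {f : Module.End K (Fock K)} (hf : ShiftsWeight d f) {m n : ℕ}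
    (h : (m : ℤ) = n + d) {b : Fock K} (hb : b ∈ weightSpace K n) : f b ∈ weightSpace K m := by
  intro s hs
  have := hf n b hb s hs
  lia

theorem ShiftsWeight.eq_zero {d : ℤ} {f : Module.End K (Fock K)} (hf : ShiftsWeight d f) {n : ℕ}
    (h : (n : ℤ) + d < 0) {b : Fock K} (hb : b ∈ weightSpace K n) : f b = 0 := by
  ext s
  by_contra hs
  have := hf n b hb s hs
  lia

/-- Cyclicity of the trace: the weight shift of the operator that is moved around turns into a
power of `q`. -/
theorem gradedTrace_comp_comm {k : ℕ} {f g : Module.End K (Fock K)} (hf : ShiftsWeight (-k) f)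
    (hg : ShiftsWeight k g) :
    gradedTrace K (g ∘ₗ f) = PowerSeries.X ^ k * gradedTrace K (f ∘ₗ g) := by
  ext n
  rw [PowerSeries.coeff_X_pow_mul']
  split_ifs with hk
  · obtain ⟨m, rfl⟩ := Nat.exists_eq_add_of_le' hk
    rw [Nat.add_sub_cancel, coeff_gradedTrace, coeff_gradedTrace]
    have h1 : compress (m + k) (g ∘ₗ f) =
        (weightProj K (m + k) ∘ₗ g ∘ₗ (weightSpace K m).subtype) ∘ₗ
          (weightProj K m ∘ₗ f ∘ₗ (weightSpace K (m + k)).subtype) := by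
      refine LinearMap.ext fun b => ?_
      change weightProj K (m + k) (g (f b)) = weightProj K (m + k) (g (weightProj K m (f b)))
      rw [weightProj_of_mem (hf.mem (by push_cast; ring) b.2)]
    have h2 : compress m (f ∘ₗ g) =
        (weightProj K m ∘ₗ f ∘ₗ (weightSpace K (m + k)).subtype) ∘ₗ
        (weightProj K (m + k) ∘ₗ g ∘ₗ (weightSpace K m).subtype) := by
      refine LinearMap.ext fun b => ?_
      change weightProj K m (f (g b)) = weightProj K m (f (weightProj K (m + k) (g b)))
      rw [weightProj_of_mem (hg.mem (by push_cast; ring) b.2)]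
    rw [h1, h2, LinearMap.trace_comp_comm']
  · have : compress n (g ∘ₗ f) = compress n 0 := compress_congr fun b hb => by
      rw [LinearMap.comp_apply, hf.eq_zero (by lia) hb, map_zero, LinearMap.zero_apply]
    rw [coeff_gradedTrace, this, map_zero, map_zero]

/-- The series `q^k / (1 - q^k) = q^k + q^(2k) + ⋯`. -/
def geom (K : Type*) [Field K] (k : ℕ) : PowerSeries K :=
  PowerSeries.mk fun n => if n ≠ 0 ∧ k ∣ n then 1 else 0

theorem geom_eq {k : ℕ} (hk : k ≠ 0) : geom K k = PowerSeries.X ^ k * (1 + geom K k) := by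
  ext n
  rw [PowerSeries.coeff_X_pow_mul']
  split_ifs with h
  · obtain ⟨m, rfl⟩ := Nat.exists_eq_add_of_le' h
    rw [Nat.add_sub_cancel, map_add, geom, PowerSeries.coeff_mk, PowerSeries.coeff_mk,
      PowerSeries.coeff_one]
    by_cases hm : m = 0 <;> simp [hm, hk]
  · rw [geom, PowerSeries.coeff_mk, if_neg]
    rintro ⟨h1, h2⟩
    exact h (Nat.le_of_dvd (Nat.pos_of_ne_zero h1) h2)

theorem eq_geom_mul {k : ℕ} (hk : k ≠ 0) {x y : PowerSeries K}
    (h : x = PowerSeries.X ^ k * (x + y)) : x = geom K k * y := by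
  have h0 : (1 - PowerSeries.X ^ k : PowerSeries K) ≠ 0 := by
    intro h1
    have := congrArg (PowerSeries.constantCoeff (R := K)) h1
    simp [hk] at this
  refine mul_left_cancel₀ h0 ?_
  linear_combination h - y * geom_eq (K := K) hk

/-- The trace of a product of two operators of opposite non-zero weight is determined by the trace
of their commutator. -/
theorem gradedTrace_comp {k : ℕ} (hk : k ≠ 0) {f g : Module.End K (Fock K)}
    (hf : ShiftsWeight (-k) f) (hg : ShiftsWeight k g) :
    gradedTrace K (g ∘ₗ f) = geom K k * gradedTrace K (f ∘ₗ g - g ∘ₗ f) := by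
  refine eq_geom_mul hk ?_
  rw [map_sub, add_sub_cancel]
  exact gradedTrace_comp_comm hf hg

/-- Multiplication by the creation operator `h(-j-1)`. -/
def mulX (K : Type*) [Field K] (j : ℕ) : Module.End K (Fock K) :=
  LinearMap.mulLeft K (MvPolynomial.X j)

@[simp]
theorem mulX_apply (j : ℕ) (b : Fock K) : mulX K j b = MvPolynomial.X j * b := rfl

/-- The derivative `∂/∂h(-j-1)`. -/
def partialX (K : Type*) [Field K] (j : ℕ) : Module.End K (Fock K) :=
  (MvPolynomial.pderiv j).toLinearMap

@[simp]
theorem partialX_apply (j : ℕ) (b : Fock K) : partialX K j b = MvPolynomial.pderiv j b := rfl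

theorem shiftsWeight_mulX (j : ℕ) : ShiftsWeight ((j + 1 : ℕ) : ℤ) (mulX K j) := by
  intro n b hb s hs
  have h := (MvPolynomial.isWeightedHomogeneous_X K wt j).mul hb hs
  rw [h, wt]
  push_cast
  ring

theorem pderiv_eq_zero {n j : ℕ} {b : Fock K} (hb : b ∈ weightSpace K n) (h : n ≤ j) :
    MvPolynomial.pderiv j b = 0 := by
  refine MvPolynomial.pderiv_eq_zero_of_notMem_vars fun hj => ?_
  obtain ⟨s, hs, hjs⟩ := (MvPolynomial.mem_vars_iff_mem_support j).mp hj
  have h2 : Finsupp.weight wt s = n := hb (MvPolynomial.mem_support_iff.mp hs)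
  have h3 := Finsupp.le_weight_of_ne_zero' wt (Finsupp.mem_support_iff.mp hjs)
  rw [h2, wt] at h3
  lia

theorem shiftsWeight_partialX (j : ℕ) : ShiftsWeight (-((j + 1 : ℕ) : ℤ)) (partialX K j) := by
  intro n b hb s hs
  rw [partialX_apply] at hs
  have hj : j < n := by
    by_contra h
    rw [pderiv_eq_zero hb (not_lt.mp h)] at hs
    simp at hs
  have h := MvPolynomial.IsWeightedHomogeneous.pderiv (n' := n - (j + 1)) (i := j) hb
    (by simp only [wt]; lia) hs
  lia

/-! ### The graded dimension of the Fock space -/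

/-- Euler's identity: on `V_(n)` the operator `∑_j h(-j-1) h(j+1)` is multiplication by `n`. -/
theorem sum_mulX_partialX {n : ℕ} (b : Fock K) (hb : b ∈ weightSpace K n) :
    ∑ j ∈ Finset.range n, ((j : K) + 1) • (mulX K j ∘ₗ partialX K j) b = (n : K) • b := by
  induction hb using MvPolynomial.IsWeightedHomogeneous.induction_on with
  | zero => simp
  | add p q hp hq h1 h2 =>
    simp only [map_add, smul_add, Finset.sum_add_distrib, h1, h2]
  | monomial d r hr =>
    simp only [LinearMap.comp_apply, mulX_apply, partialX_apply,
      MvPolynomial.X_mul_pderiv_monomial]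
    have hn : n = ∑ j ∈ Finset.range n, d j • wt j := by
      conv_lhs => rw [← hr, Finsupp.weight_apply]
      refine Finsupp.sum_of_support_subset _ (fun j hj => ?_) _ (by simp)
      have := Finsupp.le_weight_of_ne_zero' wt (Finsupp.mem_support_iff.mp hj)
      rw [hr, wt] at this
      exact Finset.mem_range.mpr this
    conv_rhs => rw [hn, Nat.cast_sum, Finset.sum_smul]
    refine Finset.sum_congr rfl fun j _ => ?_
    rw [wt, smul_eq_mul, ← Nat.cast_smul_eq_nsmul K, smul_smul]
    push_cast
    rw [mul_comm]

/-- The series `∑_n (∑_{d ∣ n} κ(d)) q^n`, which is the Lambert series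
`∑_{d ≥ 1} κ(d) q^d / (1 - q^d)`. Its constant term is zero, as `Nat.divisors 0` is empty. -/
def lambert (κ : ℕ → K) : PowerSeries K :=
  PowerSeries.mk fun n => ∑ d ∈ n.divisors, κ d

theorem coeff_mul_congr {n : ℕ} {f g : PowerSeries K} (S : PowerSeries K)
    (h : ∀ i ≤ n, PowerSeries.coeff i f = PowerSeries.coeff i g) :
    PowerSeries.coeff n (f * S) = PowerSeries.coeff n (g * S) := by
  rw [PowerSeries.coeff_mul, PowerSeries.coeff_mul]
  exact Finset.sum_congr rfl fun p hp => by
    rw [h _ (Nat.le.intro (Finset.HasAntidiagonal.mem_antidiagonal.mp hp))]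

theorem coeff_sum_geom {κ : ℕ → K} {n M : ℕ} (h : n ≤ M) :
    PowerSeries.coeff n (∑ j ∈ Finset.range M, κ (j + 1) • geom K (j + 1)) =
      PowerSeries.coeff n (lambert κ) := by
  simp only [map_sum, lambert, geom, map_smul, PowerSeries.coeff_mk, smul_eq_mul, mul_ite, mul_one,
    mul_zero]
  rw [← Finset.sum_filter]
  refine Finset.sum_nbij (· + 1) ?_ ?_ ?_ fun _ _ => rfl
  · intro j hj
    rw [Finset.mem_filter] at hj
    exact Nat.mem_divisors.mpr ⟨hj.2.2, hj.2.1⟩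
  · exact (add_left_injective 1).injOn
  · intro d hd
    rw [Finset.mem_coe, Nat.mem_divisors] at hd
    have h1 := Nat.le_of_dvd (Nat.pos_of_ne_zero hd.2) hd.1
    have h2 : d ≠ 0 := fun h0 => hd.2 (zero_dvd_iff.mp (h0 ▸ hd.1))
    refine ⟨d - 1, ?_, by simp only; lia⟩
    rw [Finset.mem_coe, Finset.mem_filter, Finset.mem_range, Nat.sub_add_cancel (by lia)]
    exact ⟨by lia, hd.2, hd.1⟩

theorem coeff_sum_geom_mul {κ : ℕ → K} {n M : ℕ} (h : n ≤ M) (S : PowerSeries K) :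
    PowerSeries.coeff n (∑ j ∈ Finset.range M, κ (j + 1) • (geom K (j + 1) * S)) =
      PowerSeries.coeff n (lambert κ * S) := by
  simp only [← smul_mul_assoc, ← Finset.sum_mul]
  exact coeff_mul_congr S fun i hi => coeff_sum_geom (hi.trans h)

theorem gradedTrace_mulX_partialX (j : ℕ) :
    gradedTrace K (mulX K j ∘ₗ partialX K j) = geom K (j + 1) * gradedTrace K LinearMap.id := by
  rw [gradedTrace_comp (Nat.succ_ne_zero j) (shiftsWeight_partialX j) (shiftsWeight_mulX j)]
  congr 2
  refine LinearMap.ext fun b => ?_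
  simp

/-- The graded dimension `D` of the Fock space satisfies `q dD/dq = (∑_n σ_1(n) q^n) D`, by Euler's
identity and the traces of the operators `h(-j-1) ∂/∂h(-j-1)`. -/
theorem X_mul_derivative_dim :
    PowerSeries.X * PowerSeries.derivative K (gradedTrace K LinearMap.id) =
      lambert (fun d => (d : K)) * gradedTrace K LinearMap.id := by
  ext n
  have h1 : PowerSeries.coeff n (PowerSeries.X *
      PowerSeries.derivative K (gradedTrace K LinearMap.id)) =
      n * PowerSeries.coeff n (gradedTrace K LinearMap.id) := by
    cases n with
    | zero => simp
    | succ n =>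
      rw [PowerSeries.coeff_succ_X_mul, PowerSeries.coeff_derivative]
      push_cast
      ring
  rw [h1, ← coeff_sum_geom_mul le_rfl]
  have h2 : compress n ((n : K) • (LinearMap.id : Module.End K (Fock K))) =
      compress n (∑ j ∈ Finset.range n, ((j : K) + 1) • (mulX K j ∘ₗ partialX K j)) := by
    refine compress_congr fun b hb => ?_
    rw [LinearMap.smul_apply, LinearMap.id_apply, ← sum_mulX_partialX b hb, LinearMap.sum_apply]
    rfl
  have h3 := congrArg (LinearMap.trace K (weightSpace K n)) h2
  rw [← coeff_gradedTrace, ← coeff_gradedTrace] at h3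
  simp only [map_smul, smul_eq_mul, map_sum, gradedTrace_mulX_partialX] at h3
  simp only [map_sum, map_smul, smul_eq_mul, h3]
  push_cast
  rfl

theorem constantCoeff_dim :
    PowerSeries.constantCoeff (gradedTrace K LinearMap.id) = 1 := by
  rw [← PowerSeries.coeff_zero_eq_constantCoeff_apply, coeff_gradedTrace]
  have h1 : compress 0 (LinearMap.id : Module.End K (Fock K)) = LinearMap.id := by
    refine LinearMap.ext fun b => Subtype.ext ?_
    exact weightProj_of_mem b.2
  have h2 : Module.finrank K (weightSpace K 0) = 1 := by
    refine finrank_eq_one ⟨1, MvPolynomial.isWeightedHomogeneous_one K wt⟩ ?_ fun b => ?_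
    · intro h
      exact one_ne_zero (congrArg Subtype.val h)
    · refine ⟨MvPolynomial.coeff 0 (b : Fock K), Subtype.ext ?_⟩
      ext s
      change MvPolynomial.coeff s (MvPolynomial.coeff 0 (b : Fock K) • (1 : Fock K)) = _
      classical
      rw [MvPolynomial.coeff_smul, MvPolynomial.coeff_one]
      split_ifs with hs
      · rw [← hs, smul_eq_mul, mul_one]
      · rw [smul_zero]
        by_contra h
        have h3 : Finsupp.weight wt s = 0 := b.2 (Ne.symm h)
        refine hs (Finsupp.ext fun j => ?_)
        have h4 := Finsupp.le_weight wt (s := j) (Nat.succ_ne_zero j) s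
        rw [h3] at h4
        exact (Nat.le_zero.mp h4).symm
  rw [h1, LinearMap.trace_id, h2, Nat.cast_one]

/-- The product `∏_{m ≥ 1} (1 - q^m)`. -/
def eulerProd (K : Type*) [Field K] : PowerSeries K :=
  PowerSeries.mk fun n => PowerSeries.coeff n (∏ m ∈ Finset.Icc 1 n, (1 - PowerSeries.X ^ m))

theorem coeff_eulerProd {k n : ℕ} (h : k ≤ n) : PowerSeries.coeff k (eulerProd K) =
    PowerSeries.coeff k (∏ m ∈ Finset.Icc 1 n, (1 - PowerSeries.X ^ m)) := by
  induction n, h using Nat.le_induction with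
  | base => rw [eulerProd, PowerSeries.coeff_mk]
  | succ n h ih =>
    rw [Finset.prod_Icc_succ_top (by lia), mul_sub, mul_one, map_sub,
      PowerSeries.coeff_mul_X_pow', if_neg (by lia), sub_zero, ih]

/-- Logarithmic differentiation of a finite product. -/
theorem X_mul_derivative_prod (n : ℕ) :
    PowerSeries.X * PowerSeries.derivative K
        (∏ m ∈ Finset.Icc 1 n, (1 - PowerSeries.X ^ m : PowerSeries K)) =
      -(∑ j ∈ Finset.range n, ((j + 1 : ℕ) : K) • (geom K (j + 1) *
        ∏ m ∈ Finset.Icc 1 n, (1 - PowerSeries.X ^ m))) := by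
  induction n with
  | zero => simp
  | succ n ih =>
    have h1 := geom_eq (K := K) (k := n + 1) (Nat.succ_ne_zero n)
    rw [Finset.prod_Icc_succ_top (by lia), Derivation.leibniz, Finset.sum_range_succ, map_sub,
      PowerSeries.derivative_pow]
    simp only [← mul_assoc (geom K _), ← smul_mul_assoc, ← Finset.sum_mul, smul_eq_mul] at ih ⊢
    simp only [PowerSeries.derivative_X, Derivation.map_one_eq_zero, Nat.add_sub_cancel,
      PowerSeries.smul_eq_C_mul, map_natCast] at ih ⊢
    generalize ∏ m ∈ Finset.Icc 1 n, (1 - PowerSeries.X ^ m : PowerSeries K) = P at *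
    linear_combination (1 - PowerSeries.X ^ (n + 1)) * ih +
      ((n + 1 : ℕ) : PowerSeries K) * P * h1

theorem X_mul_derivative_eulerProd :
    PowerSeries.X * PowerSeries.derivative K (eulerProd K) =
      -(lambert (fun d => (d : K)) * eulerProd K) := by
  ext n
  have h1 : PowerSeries.coeff n (PowerSeries.X * PowerSeries.derivative K (eulerProd K)) =
      PowerSeries.coeff n (PowerSeries.X * PowerSeries.derivative K
        (∏ m ∈ Finset.Icc 1 n, (1 - PowerSeries.X ^ m : PowerSeries K))) := by
    cases n with
    | zero => simp
    | succ n =>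
      rw [PowerSeries.coeff_succ_X_mul, PowerSeries.coeff_succ_X_mul, PowerSeries.coeff_derivative,
        PowerSeries.coeff_derivative, coeff_eulerProd le_rfl]
  rw [h1, X_mul_derivative_prod, map_neg, coeff_sum_geom_mul (κ := fun d => (d : K)) le_rfl,
    map_neg, mul_comm, mul_comm _ (eulerProd K)]
  exact congrArg Neg.neg (coeff_mul_congr _ fun i hi => (coeff_eulerProd hi).symm)

/-- The graded dimension of the Fock space is `∏_{m ≥ 1} (1 - q^m)⁻¹`: both have the same
logarithmic derivative. -/
theorem eulerProd_mul_dim [CharZero K] : eulerProd K * gradedTrace K LinearMap.id = 1 := by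
  refine PowerSeries.derivative.ext (R := K) ?_ ?_
  · refine mul_left_cancel₀ (PowerSeries.X_ne_zero (R := K)) ?_
    rw [Derivation.leibniz, Derivation.map_one_eq_zero, smul_eq_mul, smul_eq_mul]
    linear_combination eulerProd K * X_mul_derivative_dim (K := K) +
      gradedTrace K LinearMap.id * X_mul_derivative_eulerProd (K := K)
  · rw [map_mul, constantCoeff_dim, map_one, mul_one,
      ← PowerSeries.coeff_zero_eq_constantCoeff_apply, eulerProd, PowerSeries.coeff_mk]
    simp

/-! ### Powers of the Heisenberg field -/

/-- The coefficient of `z^e` in the operator-valued series `A(z)`. -/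
def mode (A : Fock K →ₗ[K] LaurentSeries (Fock K)) (e : ℤ) : Module.End K (Fock K) where
  toFun b := (A b).coeff e
  map_add' a b := by rw [map_add, HahnSeries.coeff_add]
  map_smul' c b := by rw [map_smul, HahnSeries.coeff_smul, RingHom.id_apply]

theorem mode_apply (A : Fock K →ₗ[K] LaurentSeries (Fock K)) (e : ℤ) (b : Fock K) :
    mode A e b = (A b).coeff e := rfl

/-- The field `: h(z)^k :`. -/
def fieldPow (K : Type*) [Field K] (k : ℕ) : Fock K →ₗ[K] LaurentSeries (Fock K) :=
  (Multiset.replicate k 0).foldr normalOrder (HahnSeries.single.linearMap (0 : ℤ))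

theorem fieldPow_zero_apply (b : Fock K) : fieldPow K 0 b = HahnSeries.single 0 b := rfl

theorem fieldPow_succ (k : ℕ) : fieldPow K (k + 1) = normalOrder 0 (fieldPow K k) := by
  rw [fieldPow, Multiset.replicate_succ, Multiset.foldr_cons, fieldPow]

theorem hasDegree_fieldPow (k n : ℕ) (b : Fock K) (hb : b ∈ weightSpace K n) :
    HasDegree (k + n) (fieldPow K k b) := by
  simpa [wt, fieldPow] using HasDegree.foldr (Multiset.replicate k 0) n b hb

theorem shiftsWeight_mode (k : ℕ) (e : ℤ) : ShiftsWeight (k + e) (mode (fieldPow K k) e) := by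
  intro n b hb s hs
  have := hasDegree_fieldPow k n b hb e s hs
  lia

theorem pderiv_X_mul (i j : ℕ) (b : Fock K) :
    MvPolynomial.pderiv i (MvPolynomial.X j * b) =
      (if i = j then b else 0) + MvPolynomial.X j * MvPolynomial.pderiv i b := by
  classical
  rw [Derivation.leibniz, MvPolynomial.pderiv_X, Pi.single_apply, smul_eq_mul, smul_eq_mul,
    mul_ite, mul_one, mul_zero, add_comm]
  simp only [eq_comm]

/-- The commutator of a normally ordered product with a creation operator. -/
theorem normalOrder_X_mul (n j : ℕ) {A B : Fock K →ₗ[K] LaurentSeries (Fock K)}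
    (h : ∀ b, A (MvPolynomial.X j * b) = HahnSeries.C (MvPolynomial.X j) * A b + B b)
    (b : Fock K) :
    normalOrder n A (MvPolynomial.X j * b) =
      HahnSeries.C (MvPolynomial.X j) * normalOrder n A b + annCoeff K n j * A b +
        normalOrder n B b := by
  classical
  set S := insert j ((totalDiff K (MvPolynomial.X j * b)).support ∪ (totalDiff K b).support)
  have hj : j ∈ S := Finset.mem_insert_self _ _
  have hS : (totalDiff K b).support ⊆ S :=
    Finset.subset_union_right.trans (Finset.subset_insert _ _)
  rw [normalOrder_apply n A _ S (Finset.subset_union_left.trans (Finset.subset_insert _ _)),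
    normalOrder_apply n A b S hS, normalOrder_apply n B b S hS]
  have e1 : ∑ i ∈ S, annCoeff K n i * A (if i = j then b else 0) = annCoeff K n j * A b := by
    rw [Finset.sum_eq_single j (fun i _ hi => by rw [if_neg hi, map_zero, mul_zero])
      (fun h => absurd hj h), if_pos rfl]
  simp only [pderiv_X_mul, h, map_add, mul_add, Finset.sum_add_distrib, e1, Finset.mul_sum]
  simp only [mul_left_comm (HahnSeries.C _)]
  abel

/-- The derivative `∂/∂h(-j-1)` of the coefficients of a Laurent series. -/
def coeffDeriv (j : ℕ) (x : LaurentSeries (Fock K)) : LaurentSeries (Fock K) :=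
  x.map (MvPolynomial.pderiv j : Derivation K (Fock K) (Fock K))

@[simp]
theorem coeff_coeffDeriv (j : ℕ) (x : LaurentSeries (Fock K)) (e : ℤ) :
    (coeffDeriv j x).coeff e = MvPolynomial.pderiv j (x.coeff e) := rfl

theorem coeffDeriv_add (j : ℕ) (x y : LaurentSeries (Fock K)) :
    coeffDeriv j (x + y) = coeffDeriv j x + coeffDeriv j y := by
  ext1; ext1 e
  simp

theorem coeffDeriv_sum {ι : Type*} (j : ℕ) (s : Finset ι) (x : ι → LaurentSeries (Fock K)) :
    coeffDeriv j (∑ i ∈ s, x i) = ∑ i ∈ s, coeffDeriv j (x i) := by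
  ext1; ext1 e
  simp

theorem coeffDeriv_mul (j : ℕ) (x y : LaurentSeries (Fock K)) :
    coeffDeriv j (x * y) = coeffDeriv j x * y + x * coeffDeriv j y := by
  have h (x : LaurentSeries (Fock K)) : (coeffDeriv j x).support ⊆ x.support := by
    intro e he h0
    refine he ?_
    change MvPolynomial.pderiv j (x.coeff e) = 0
    rw [h0, map_zero]
  ext1; ext1 e
  rw [coeff_coeffDeriv, HahnSeries.coeff_add, HahnSeries.coeff_mul,
    HahnSeries.coeff_mul_left' x.isPWO_support (h x),
    HahnSeries.coeff_mul_right' y.isPWO_support (h y), map_sum, ← Finset.sum_add_distrib]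
  refine Finset.sum_congr rfl fun p _ => ?_
  rw [Derivation.leibniz, smul_eq_mul, smul_eq_mul, coeff_coeffDeriv, coeff_coeffDeriv]
  ring

theorem coeffDeriv_annCoeff (i n j : ℕ) : coeffDeriv i (annCoeff K n j) = 0 := by
  ext1; ext1 e
  rw [coeff_coeffDeriv, annCoeff, HahnSeries.coeff_single]
  split_ifs <;> simp

theorem coeffDeriv_creation (j : ℕ) : coeffDeriv j (creation K 0) = HahnSeries.single (j : ℤ) 1 := by
  classical
  ext1; ext1 e
  rw [coeff_coeffDeriv, creation, PowerSeries.coeff_coe, HahnSeries.coeff_single]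
  split_ifs with h1 h2 h2
  · lia
  · rw [map_zero]
  · rw [PowerSeries.coeff_mk, h2]
    simp
  · rw [PowerSeries.coeff_mk]
    have : e.natAbs ≠ j := by lia
    simp [this]

/-- The commutator of an annihilation operator with a normally ordered product. -/
theorem coeffDeriv_normalOrder (j : ℕ) {A B : Fock K →ₗ[K] LaurentSeries (Fock K)}
    (h : ∀ b, coeffDeriv j (A b) = A (MvPolynomial.pderiv j b) + B b) (b : Fock K) :
    coeffDeriv j (normalOrder 0 A b) =
      normalOrder 0 A (MvPolynomial.pderiv j b) + HahnSeries.single (j : ℤ) 1 * A b +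
        normalOrder 0 B b := by
  rw [normalOrder_apply 0 A b _ subset_rfl, normalOrder_apply 0 B b _ subset_rfl,
    normalOrder_apply 0 A _ _ (support_pderiv b j)]
  simp only [coeffDeriv_add, coeffDeriv_sum, coeffDeriv_mul, coeffDeriv_creation,
    coeffDeriv_annCoeff, h, zero_mul, zero_add, mul_add, Finset.sum_add_distrib, pderiv_comm b j]
  abel

theorem normalOrder_smul (n : ℕ) (B : Fock K →ₗ[K] LaurentSeries (Fock K))
    (x : LaurentSeries (Fock K)) (k : ℕ) :
    normalOrder n (k • (mulOp x ∘ₗ B)) = k • (mulOp x ∘ₗ normalOrder n B) := by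
  refine LinearMap.ext fun b => ?_
  have hm (y : LaurentSeries (Fock K)) : mulOp (K := K) x y = x * y := rfl
  simp only [LinearMap.smul_apply, LinearMap.comp_apply, hm,
    normalOrder_apply n _ b _ subset_rfl, mul_add, Finset.mul_sum, smul_add, Finset.smul_sum,
    mul_smul_comm, mul_left_comm x]

/-- The commutator of `: h(z)^k :` and `h(-j-1)` is `k (j+1) z^(-j-2) : h(z)^(k-1) :`. The truncated
`k - 1` is harmless at `k = 0`, where the factor `k` vanishes. -/
theorem fieldPow_X_mul (k j : ℕ) (b : Fock K) :
    fieldPow K k (MvPolynomial.X j * b) = HahnSeries.C (MvPolynomial.X j) * fieldPow K k b +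
      (k • (mulOp (annCoeff K 0 j) ∘ₗ fieldPow K (k - 1))) b := by
  induction k generalizing b with
  | zero =>
    rw [zero_smul, LinearMap.zero_apply, add_zero, fieldPow_zero_apply, fieldPow_zero_apply,
      HahnSeries.C_apply, HahnSeries.single_mul_single, add_zero]
  | succ k ih =>
    rw [fieldPow_succ, normalOrder_X_mul 0 j ih, normalOrder_smul, Nat.add_sub_cancel, add_assoc]
    congr 1
    cases k with
    | zero => simp [mulOp]
    | succ k =>
      rw [Nat.add_sub_cancel, ← fieldPow_succ, add_smul (k + 1) 1, one_smul, add_comm]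
      rfl

/-- The commutator of `∂/∂h(-j-1)` and `: h(z)^k :` is `k z^j : h(z)^(k-1) :`. -/
theorem coeffDeriv_fieldPow (k j : ℕ) (b : Fock K) :
    coeffDeriv j (fieldPow K k b) = fieldPow K k (MvPolynomial.pderiv j b) +
      (k • (mulOp (HahnSeries.single (j : ℤ) 1) ∘ₗ fieldPow K (k - 1))) b := by
  induction k generalizing b with
  | zero =>
    ext1; ext1 e
    rw [zero_smul, LinearMap.zero_apply, add_zero, fieldPow_zero_apply, fieldPow_zero_apply,
      coeff_coeffDeriv, HahnSeries.coeff_single, HahnSeries.coeff_single]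
    split_ifs <;> simp
  | succ k ih =>
    rw [fieldPow_succ, coeffDeriv_normalOrder j ih, normalOrder_smul, Nat.add_sub_cancel, add_assoc]
    congr 1
    cases k with
    | zero => simp [mulOp]
    | succ k =>
      rw [Nat.add_sub_cancel, ← fieldPow_succ, add_smul (k + 1) 1, one_smul, add_comm]
      rfl

/-! ### Traces of normally ordered products -/

/-- The series `∑_n Tr_{V_(n)} o(h(-1)^k) q^n`. -/
def tracePow (K : Type*) [Field K] (k : ℕ) : PowerSeries K :=
  gradedTrace K (mode (fieldPow K k) (-k))

theorem coeff_single_mul' (c : ℤ) (x : Fock K) (y : LaurentSeries (Fock K)) (e : ℤ) :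
    (HahnSeries.single c x * y).coeff e = x * y.coeff (e - c) := by
  have := HahnSeries.coeff_single_mul_add (r := x) (x := y) (a := e - c) (b := c)
  rwa [sub_add_cancel] at this

theorem gradedTrace_mulX_mode (k j : ℕ) :
    gradedTrace K (mulX K j ∘ₗ mode (fieldPow K k) (-(k + j + 1))) =
      ((k : K) * (j + 1)) • (geom K (j + 1) * tracePow K (k - 1)) := by
  have hf : ShiftsWeight (-((j + 1 : ℕ) : ℤ)) (mode (fieldPow K k) (-(k + j + 1))) := by
    have h := shiftsWeight_mode (K := K) k (-(k + j + 1))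
    rwa [show (k + -(k + j + 1) : ℤ) = -((j + 1 : ℕ) : ℤ) by push_cast; ring] at h
  rw [gradedTrace_comp (Nat.succ_ne_zero j) hf (shiftsWeight_mulX j), tracePow, ← mul_smul_comm,
    ← map_smul]
  congr 2
  refine LinearMap.ext fun b => ?_
  rw [LinearMap.sub_apply, LinearMap.comp_apply, LinearMap.comp_apply, mulX_apply, mode_apply,
    fieldPow_X_mul, HahnSeries.coeff_add, HahnSeries.C_mul_eq_smul, HahnSeries.coeff_smul,
    smul_eq_mul, mulX_apply, mode_apply,
    add_sub_cancel_left]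
  cases k with
  | zero => simp
  | succ k =>
    change ((k + 1) • (annCoeff K 0 j * fieldPow K k b)).coeff _ =
      (((k + 1 : ℕ) : K) * (j + 1)) • (fieldPow K k b).coeff _
    rw [HahnSeries.coeff_smul, annCoeff, coeff_single_mul', ← MvPolynomial.smul_eq_C_mul,
      ← Nat.cast_smul_eq_nsmul K, smul_smul]
    congr 2
    · simp
    · push_cast
      ring

theorem gradedTrace_mode_partialX (k j : ℕ) :
    gradedTrace K (mode (fieldPow K k) (j + 1 - k) ∘ₗ partialX K j) =
      (k : K) • (geom K (j + 1) * tracePow K (k - 1)) := by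
  have hg : ShiftsWeight ((j + 1 : ℕ) : ℤ) (mode (fieldPow K k) (j + 1 - k)) := by
    have h := shiftsWeight_mode (K := K) k (j + 1 - k)
    rwa [show (k + (j + 1 - k) : ℤ) = ((j + 1 : ℕ) : ℤ) by push_cast; ring] at h
  rw [gradedTrace_comp (Nat.succ_ne_zero j) (shiftsWeight_partialX j) hg, tracePow,
    ← mul_smul_comm, ← map_smul]
  congr 2
  refine LinearMap.ext fun b => ?_
  rw [LinearMap.sub_apply, LinearMap.comp_apply, LinearMap.comp_apply, partialX_apply, mode_apply,
    ← coeff_coeffDeriv, coeffDeriv_fieldPow, HahnSeries.coeff_add, partialX_apply, mode_apply,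
    add_sub_cancel_left]
  cases k with
  | zero => simp
  | succ k =>
    change ((k + 1) • (HahnSeries.single (j : ℤ) 1 * fieldPow K k b)).coeff _ =
      ((k + 1 : ℕ) : K) • (fieldPow K k b).coeff _
    rw [HahnSeries.coeff_smul, coeff_single_mul', one_mul, ← Nat.cast_smul_eq_nsmul K]
    congr 2
    push_cast
    ring

/-- A coefficient of the product of a power series and a Laurent series, as a finite sum. -/
theorem coeff_ofPowerSeries_mul {R : Type*} [CommRing R] (N : ℕ) (f : PowerSeries R)
    (y : LaurentSeries R) (e : ℤ) (h : ∀ i : ℤ, i ≤ e - N → y.coeff i = 0) :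
    (HahnSeries.ofPowerSeries ℤ R f * y).coeff e =
      ∑ i ∈ Finset.range N, PowerSeries.coeff i f * y.coeff (e - i) := by
  induction N generalizing f e with
  | zero =>
    rw [Finset.sum_range_zero, HahnSeries.coeff_mul]
    refine Finset.sum_eq_zero fun p hp => ?_
    have hp3 := (Finset.mem_antidiagonal.mp hp).2.2
    rw [PowerSeries.coeff_coe]
    split_ifs with h0
    · rw [zero_mul]
    · rw [h _ (by push_cast; lia), mul_zero]
  | succ N ih =>
    rw [PowerSeries.eq_X_mul_shift_add_const f, map_add, map_mul, HahnSeries.ofPowerSeries_X,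
      HahnSeries.ofPowerSeries_C, add_mul, HahnSeries.coeff_add, mul_assoc,
      HahnSeries.C_mul_eq_smul, HahnSeries.coeff_smul, Finset.sum_range_succ']
    have h1 := HahnSeries.coeff_single_mul_add (r := (1 : R)) (a := e - 1) (b := 1)
      (x := HahnSeries.ofPowerSeries ℤ R (PowerSeries.mk fun p => PowerSeries.coeff (p + 1) f) * y)
    rw [sub_add_cancel] at h1
    rw [h1, one_mul, ih _ _ fun i hi => h i (by push_cast; lia)]
    congr 1
    · refine Finset.sum_congr rfl fun i _ => ?_
      rw [map_add, PowerSeries.coeff_succ_X_mul, PowerSeries.coeff_C, if_neg (Nat.succ_ne_zero i),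
        add_zero, sub_sub, add_comm (1 : ℤ)]
      push_cast
      rfl
    · simp

/-- The coefficient of `q^d / (1 - q^d)` in the contraction of `∂^(m) h(z)` and `h(z)`, at `z = 1`. The
two summands come from the creation and the annihilation part of `∂^(m) h(z)`. -/
def contractionCoeff (K : Type*) [Field K] (m d : ℕ) : K :=
  d * (((d - 1).choose m : K) + (-1) ^ m * ((d + m).choose m : K))

/-- The contraction of `∂^(m) h(z)` and `h(z)` at `z = 1`: the trace of `: ∂^(m) h(z) h(z) :`, divided
by the graded dimension. -/
def contraction (K : Type*) [Field K] (m : ℕ) : PowerSeries K :=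
  lambert (contractionCoeff K m)

/-- The zero mode of `: ∂^(m) h(z) h(z)^k :` on `V_(n)` as a finite sum: annihilation operators
`h(j+1)` with `j ≥ n` vanish on `V_(n)`, and so does the coefficient of `h(-j-1)` for `j ≥ n + m`,
since it would lower the weight below zero. -/
theorem mode_normalOrder (k m n : ℕ) (b : Fock K) (hb : b ∈ weightSpace K n) :
    mode (normalOrder m (fieldPow K k)) (-(k + m + 1)) b =
      (∑ j ∈ Finset.range (n + m), ((j.choose m : K) • (mulX K j ∘ₗ
          mode (fieldPow K k) (-(k + j + 1))) +
        ((-1) ^ m * ((j + m + 1).choose m : K) * (j + 1)) • (mode (fieldPow K k) (j + 1 - k) ∘ₗ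
          partialX K j))) b := by
  have hS : (totalDiff K b).support ⊆ Finset.range (n + m) := by
    intro j hj
    rw [Finsupp.mem_support_iff, totalDiff_apply] at hj
    rw [Finset.mem_range]
    by_contra h
    exact hj (pderiv_eq_zero hb (by lia))
  rw [mode_apply, normalOrder_apply m _ b _ hS, HahnSeries.coeff_add, HahnSeries.coeff_sum,
    Finset.sum_add_distrib, LinearMap.add_apply, LinearMap.sum_apply, LinearMap.sum_apply]
  congr 1
  · rw [creation, coeff_ofPowerSeries_mul n, add_comm n m, Finset.sum_range_add,
      Finset.sum_eq_zero (s := Finset.range m), zero_add]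
    · refine Finset.sum_congr rfl fun i _ => ?_
      rw [PowerSeries.coeff_mk, LinearMap.smul_apply, LinearMap.comp_apply, mulX_apply, mode_apply,
        MvPolynomial.smul_eq_C_mul, map_natCast, add_comm m i, mul_assoc]
      congr 3
      push_cast
      ring
    · intro j hj
      rw [Nat.choose_eq_zero_of_lt (Finset.mem_range.mp hj), Nat.cast_zero, zero_smul,
        LinearMap.zero_apply]
    · intro i hi
      ext s
      by_contra hs
      have := hasDegree_fieldPow k n b hb i s hs
      lia
  · refine Finset.sum_congr rfl fun j _ => ?_
    rw [annCoeff, coeff_single_mul', LinearMap.smul_apply, LinearMap.comp_apply, mode_apply,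
      partialX_apply, MvPolynomial.smul_eq_C_mul]
    congr 2
    ring

/-- Wick's theorem for the trace of `: ∂^(m) h(z) h(z)^k :`. -/
theorem gradedTrace_normalOrder (k m : ℕ) :
    gradedTrace K (mode (normalOrder m (fieldPow K k)) (-(k + m + 1))) =
      (k : K) • (contraction K m * tracePow K (k - 1)) := by
  ext n
  rw [coeff_gradedTrace, compress_congr (mode_normalOrder k m n), ← coeff_gradedTrace, map_smul,
    contraction, ← coeff_sum_geom_mul (M := n + m) (by lia), ← map_smul, Finset.smul_sum, map_sum]
  congr 1
  refine Finset.sum_congr rfl fun j _ => ?_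
  rw [map_add, map_smul, map_smul, gradedTrace_mulX_mode, gradedTrace_mode_partialX, smul_smul,
    smul_smul, smul_smul, ← add_smul, contractionCoeff, Nat.add_sub_cancel]
  congr 1
  rw [show j + m + 1 = j + 1 + m by ring]
  push_cast
  ring

/-! ### The character as a linear functional -/

theorem zeroMode_of_mem {k : ℕ} {a : Fock K} (ha : a ∈ weightSpace K k) :
    zeroMode a = (Y K a)[[(k : ℤ) - 1]] := by
  rw [zeroMode, finsum_eq_single _ k,
    MvPolynomial.IsWeightedHomogeneous.weightedHomogeneousComponent_same ha]
  intro i hi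
  rw [MvPolynomial.IsWeightedHomogeneous.weightedHomogeneousComponent_ne i ha hi, map_zero,
    map_zero]
  rfl

theorem finite_support_zeroMode (a : Fock K) : (Function.support fun k : ℕ =>
    (Y K (MvPolynomial.weightedHomogeneousComponent wt k a))[[(k : ℤ) - 1]]).Finite := by
  refine (MvPolynomial.weightedHomogeneousComponent_finsupp (w := wt) a).subset fun k hk h => hk ?_
  simp only [h, map_zero]
  rfl

/-- The zero mode as a linear map. -/
def zeroModeHom (K : Type*) [Field K] : Fock K →ₗ[K] Module.End K (Fock K) where
  toFun := zeroMode
  map_add' a b := by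
    rw [zeroMode, zeroMode, zeroMode, ← finsum_add_distrib (finite_support_zeroMode a)
      (finite_support_zeroMode b)]
    simp only [map_add]
    rfl
  map_smul' c a := by
    rw [zeroMode, zeroMode, RingHom.id_apply, smul_finsum]
    simp only [map_smul]
    rfl

/-- The power series `∏_{m ≥ 1} (1 - q^m) ∑_n Tr_{V_(n)} o(a) q^n`. -/
def expectation (K : Type*) [Field K] : Fock K →ₗ[K] PowerSeries K :=
  LinearMap.mulLeft K (eulerProd K) ∘ₗ gradedTrace K ∘ₗ zeroModeHom K

theorem expectation_apply (a : Fock K) :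
    expectation K a = eulerProd K * gradedTrace K (zeroMode a) := rfl

theorem rescaledCharacter_eq (a : Fock K) :
    rescaledCharacter a = HahnSeries.ofPowerSeries ℚ K (expectation K a) := by
  have h : (PowerSeries.mk fun n =>
      LinearMap.trace K (weightSpace K n) ((zeroMode a).restrict (zeroMode_mem a n))) =
      gradedTrace K (zeroMode a) := by
    ext n
    rw [PowerSeries.coeff_mk, coeff_gradedTrace]
    congr 1
    exact LinearMap.ext fun b => Subtype.ext (weightProj_of_mem (zeroMode_mem a n b b.2)).symm
  rw [rescaledCharacter, eta, character, h, expectation_apply, map_mul, eulerProd, mul_mul_mul_comm,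
    HahnSeries.single_mul_single]
  norm_num

theorem Y_monomial (s : ℕ →₀ ℕ) : Y K (MvPolynomial.monomial s 1) = toVertexOperator
    ((Finsupp.toMultiset s).foldr normalOrder (HahnSeries.single.linearMap (0 : ℤ))) := by
  have h := (MvPolynomial.basisMonomials ℕ K).constr_basis K (fun s => toVertexOperator (K := K)
      ((Finsupp.toMultiset s).foldr normalOrder (HahnSeries.single.linearMap (0 : ℤ)))) s
  rwa [MvPolynomial.coe_basisMonomials] at h

theorem Y_X_zero_pow (k : ℕ) :
    Y K (MvPolynomial.X 0 ^ k) = toVertexOperator (fieldPow K k) := by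
  rw [MvPolynomial.X_pow_eq_monomial, Y_monomial, Finsupp.toMultiset_single,
    Multiset.nsmul_singleton, fieldPow]

theorem Y_X_mul_X_zero_pow (m k : ℕ) : Y K (MvPolynomial.X m * MvPolynomial.X 0 ^ k) =
    toVertexOperator (normalOrder m (fieldPow K k)) := by
  rw [MvPolynomial.X_pow_eq_monomial, MvPolynomial.X, MvPolynomial.monomial_mul, one_mul,
    Y_monomial, map_add, Finsupp.toMultiset_single, Finsupp.toMultiset_single, one_smul,
    Multiset.nsmul_singleton, Multiset.singleton_add, Multiset.foldr_cons, fieldPow]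

theorem ncoeff_toVertexOperator (A : Fock K →ₗ[K] LaurentSeries (Fock K)) (n : ℤ) :
    (toVertexOperator A)[[n]] = mode A (-n - 1) := rfl

theorem gradedTrace_zeroMode_X_zero_pow (k : ℕ) :
    gradedTrace K (zeroMode (MvPolynomial.X 0 ^ k)) = tracePow K k := by
  have h : (MvPolynomial.X 0 ^ k : Fock K) ∈ weightSpace K k := by
    simpa [wt] using (MvPolynomial.isWeightedHomogeneous_X K wt 0).pow k
  rw [zeroMode_of_mem h, Y_X_zero_pow, ncoeff_toVertexOperator, tracePow]
  congr 2
  ring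

theorem expectation_one [CharZero K] : expectation K 1 = 1 := by
  rw [← pow_zero (MvPolynomial.X 0 : Fock K), expectation_apply, gradedTrace_zeroMode_X_zero_pow,
    tracePow, ← eulerProd_mul_dim (K := K)]
  congr 2
  refine LinearMap.ext fun b => ?_
  rw [mode_apply, fieldPow_zero_apply, Nat.cast_zero, neg_zero, HahnSeries.coeff_single_same]
  rfl

theorem expectation_X_mul_X_zero_pow (m k : ℕ) :
    expectation K (MvPolynomial.X m * MvPolynomial.X 0 ^ k) =
      (k : K) • (contraction K m * expectation K (MvPolynomial.X 0 ^ (k - 1))) := by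
  have h : (MvPolynomial.X m * MvPolynomial.X 0 ^ k : Fock K) ∈ weightSpace K (m + 1 + k) := by
    have h1 := (MvPolynomial.isWeightedHomogeneous_X K wt 0).pow k
    have h2 := (MvPolynomial.isWeightedHomogeneous_X K wt m).mul h1
    simpa [wt] using h2
  rw [expectation_apply, expectation_apply, gradedTrace_zeroMode_X_zero_pow, zeroMode_of_mem h,
    Y_X_mul_X_zero_pow, ncoeff_toVertexOperator, mul_left_comm, ← mul_smul_comm,
    ← gradedTrace_normalOrder]
  congr 4
  push_cast
  ring

/-- Gaussian integration by parts for the character, on polynomials in `h(-1)`. -/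
theorem expectation_X_mul_aeval (m : ℕ) (p : Polynomial K) :
    expectation K (MvPolynomial.X m * Polynomial.aeval (MvPolynomial.X 0) p) =
      contraction K m *
        expectation K (Polynomial.aeval (MvPolynomial.X 0) (Polynomial.derivative p)) := by
  induction p using Polynomial.induction_on' with
  | add p q hp hq => simp only [map_add, mul_add, hp, hq]
  | monomial k c =>
    rw [Polynomial.derivative_monomial, Polynomial.aeval_monomial, Polynomial.aeval_monomial,
      ← Algebra.smul_def, ← Algebra.smul_def, mul_smul_comm, map_smul, map_smul,
      expectation_X_mul_X_zero_pow, smul_smul, mul_smul_comm]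

/-! ### Binomial sums in powers of `e^z - 1` -/

theorem sum_choose_mul_add_one {R : Type*} [CommRing R] (y : R) (d r : ℕ) :
    (∑ i ∈ Finset.range r, (-1) ^ i * ((d + 1 + i).choose i : R) * y ^ i) * (1 + y) =
      (∑ i ∈ Finset.range r, (-1) ^ i * ((d + i).choose i : R) * y ^ i) -
        (-1) ^ r * ((d + r).choose (d + 1) : R) * y ^ r := by
  induction r with
  | zero => simp
  | succ r ih =>
    have h1 : ((d + 1 + r).choose r : R) = (d + r).choose r + (d + r).choose (d + 1) := by
      rw [← Nat.choose_symm_add, show d + 1 + r = d + r + 1 by ring, Nat.choose_succ_succ,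
        Nat.choose_symm_add]
      push_cast
      ring
    have h2 : ((d + (r + 1)).choose (d + 1) : R) = (d + 1 + r).choose r := by
      rw [← Nat.choose_symm_add, show d + (r + 1) = d + 1 + r by ring]
    rw [Finset.sum_range_succ, Finset.sum_range_succ, add_mul, ih, h2, h1]
    ring

/-- The truncated binomial series of `(1 + y)^(-d-1)`. -/
theorem pow_dvd_sum_choose_mul_pow {R : Type*} [CommRing R] (y : R) (d r : ℕ) :
    y ^ r ∣ (∑ i ∈ Finset.range r, (-1) ^ i * ((d + i).choose i : R) * y ^ i) *
      (1 + y) ^ (d + 1) - 1 := by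
  induction d with
  | zero =>
    have h := geom_sum_mul (-y) r
    refine ⟨-(-1) ^ r, ?_⟩
    simp only [zero_add, Nat.choose_self, Nat.cast_one, mul_one, ← mul_pow, pow_one, neg_one_mul]
    rw [neg_pow y r] at h
    linear_combination -h
  | succ d ih =>
    obtain ⟨c, hc⟩ := ih
    refine ⟨c - (-1) ^ r * ((d + r).choose (d + 1) : R) * (1 + y) ^ (d + 1), ?_⟩
    linear_combination (1 + y) ^ (d + 1) * sum_choose_mul_add_one y d r + hc

variable [CharZero K]

theorem X_dvd_exp_sub_one : (PowerSeries.X : PowerSeries K) ∣ PowerSeries.exp K - 1 := by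
  rw [PowerSeries.X_dvd_iff]
  simp

theorem coeff_exp_sub_one_pow_mul {r i : ℕ} (h : r < i) (f : PowerSeries K) :
    PowerSeries.coeff r ((PowerSeries.exp K - 1) ^ i * f) = 0 :=
  PowerSeries.X_pow_dvd_iff.mp (dvd_mul_of_dvd_left (pow_dvd_pow_of_dvd X_dvd_exp_sub_one i) f) r h

theorem coeff_exp_pow (d n : ℕ) :
    PowerSeries.coeff n (PowerSeries.exp K ^ d) = (d : K) ^ n / (n ! : K) := by
  rw [PowerSeries.exp_pow_eq_rescale_exp, PowerSeries.coeff_rescale, PowerSeries.coeff_exp]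
  simp [div_eq_mul_inv]

/-- The coefficient of `h(-i-1)` in the square-bracket mode `h[-r-1]`. -/
def creationWeight (K : Type*) [Field K] [CharZero K] (r i : ℕ) : K :=
  PowerSeries.coeff r ((PowerSeries.exp K - 1) ^ i * PowerSeries.exp K)

/-- Expand `(e^z)^(d+1) = e^z (1 + (e^z - 1))^d` and compare the coefficients of `z^r`. -/
theorem sum_creationWeight_choose (r d : ℕ) :
    ∑ i ∈ Finset.range (r + 1), creationWeight K r i * (d.choose i : K) =
      ((d + 1 : ℕ) : K) ^ r / (r ! : K) := by
  rw [← coeff_exp_pow, pow_succ]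
  have h : PowerSeries.exp K ^ d = ∑ i ∈ Finset.range (d + 1),
      (PowerSeries.exp K - 1) ^ i * (d.choose i : PowerSeries K) := by
    conv_lhs => rw [← sub_add_cancel (PowerSeries.exp K) 1, add_pow]
    simp only [one_pow, mul_one]
  have h2 (i : ℕ) : PowerSeries.coeff r ((PowerSeries.exp K - 1) ^ i *
      (d.choose i : PowerSeries K) * PowerSeries.exp K) =
      creationWeight K r i * (d.choose i : K) := by
    rw [mul_right_comm, ← map_natCast (PowerSeries.C (R := K)), PowerSeries.coeff_mul_C,
      creationWeight]
  rw [h, Finset.sum_mul, map_sum]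
  simp only [h2]
  rw [Finset.sum_subset (Finset.range_mono (show r + 1 ≤ r + 1 + (d + 1) by lia)),
    Finset.sum_subset (Finset.range_mono (show d + 1 ≤ r + 1 + (d + 1) by lia))]
  · intro i _ hi
    rw [Finset.mem_range, not_lt] at hi
    rw [Nat.choose_eq_zero_of_lt (by lia), Nat.cast_zero, mul_zero]
  · intro i _ hi
    rw [Finset.mem_range, not_lt] at hi
    rw [creationWeight, coeff_exp_sub_one_pow_mul (by lia), zero_mul]

/-- Expand `(e^z)^(-d) = e^z (1 + (e^z - 1))^(-d-1)` and compare the coefficients of `z^r`. -/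
theorem sum_creationWeight_neg_choose (r d : ℕ) :
    ∑ i ∈ Finset.range (r + 1), creationWeight K r i * ((-1) ^ i * ((d + i).choose i : K)) =
      (-(d : K)) ^ r / (r ! : K) := by
  obtain ⟨c, hc⟩ := pow_dvd_sum_choose_mul_pow (PowerSeries.exp K - 1) d (r + 1)
  rw [add_sub_cancel] at hc
  have h1 := PowerSeries.exp_mul_exp_neg_eq_one (A := K)
  set u := PowerSeries.evalNegHom (PowerSeries.exp K) with hu
  set Q := ∑ i ∈ Finset.range (r + 1), (-1) ^ i * ((d + i).choose i : PowerSeries K) *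
    (PowerSeries.exp K - 1) ^ i with hQ
  have h2 : PowerSeries.exp K ^ d * u ^ d = 1 := by rw [← mul_pow, h1, one_pow]
  have h3 : Q * PowerSeries.exp K =
      u ^ d + (PowerSeries.exp K - 1) ^ (r + 1) * (c * u ^ d) := by
    linear_combination u ^ d * hc - Q * PowerSeries.exp K * h2
  have h4 := congrArg (PowerSeries.coeff r) h3
  rw [map_add, coeff_exp_sub_one_pow_mul (Nat.lt_succ_self r), add_zero, hu, ← map_pow,
    PowerSeries.evalNegHom, PowerSeries.coeff_rescale, coeff_exp_pow, hQ, Finset.sum_mul,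
    map_sum] at h4
  rw [neg_pow, mul_div_assoc, ← h4]
  refine Finset.sum_congr rfl fun i _ => ?_
  have h5 : (-1) ^ i * ((d + i).choose i : PowerSeries K) * (PowerSeries.exp K - 1) ^ i *
      PowerSeries.exp K = ((PowerSeries.exp K - 1) ^ i * PowerSeries.exp K) *
        PowerSeries.C ((-1) ^ i * ((d + i).choose i : K)) := by
    rw [map_mul, map_pow, map_neg, map_one, map_natCast]
    ring
  rw [h5, PowerSeries.coeff_mul_C, creationWeight]

/-! ### Square-bracket modes on polynomials in `h(-1)` -/

theorem coeff_residue_creation (r i : ℕ) :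
    ((expSeries K - 1) ^ (-(-((i : ℤ) + 1)) - 1) * expSeries K *
      HahnSeries.single (-((r + 1 : ℕ) : ℤ)) 1).coeff (-1) = creationWeight K r i := by
  have h1 : (expSeries K - 1) ^ (-(-((i : ℤ) + 1)) - 1) * expSeries K =
      HahnSeries.ofPowerSeries ℤ K ((PowerSeries.exp K - 1) ^ i * PowerSeries.exp K) := by
    rw [neg_neg, add_sub_cancel_right, zpow_natCast, expSeries, map_mul, map_pow, map_sub, map_one]
  rw [h1, HahnSeries.coeff_mul_single, mul_one,
    show (-1 - -((r + 1 : ℕ) : ℤ)) = (r : ℤ) by push_cast; ring, creationWeight]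
  exact HahnSeries.ofPowerSeries_apply_coeff _ _

/-- The coefficient of `h(1)` in the square-bracket mode `h[-r-1]`. -/
def annihilationWeight (K : Type*) [Field K] [CharZero K] (r : ℕ) : K :=
  -((bernoulli (r + 2) : ℚ) : K) / ((r + 2) * (r ! : K))

/-- The identity `e^z / (e^z - 1)^2 = -d/dz (1 / (e^z - 1))`, with `z / (e^z - 1)` the generating
series `B` of the Bernoulli numbers: `B^2 e^z = B - z dB/dz`. -/
theorem bernoulli_sq_mul_exp :
    bernoulliPowerSeries K ^ 2 * PowerSeries.exp K = bernoulliPowerSeries K -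
      PowerSeries.X * PowerSeries.derivative K (bernoulliPowerSeries K) := by
  have h1 := bernoulliPowerSeries_mul_exp_sub_one K
  have h2 := congrArg (PowerSeries.derivative K) h1
  rw [Derivation.leibniz, map_sub, PowerSeries.derivative_exp, Derivation.map_one_eq_zero, sub_zero,
    PowerSeries.derivative_X, smul_eq_mul, smul_eq_mul] at h2
  linear_combination bernoulliPowerSeries K * h2 -
    PowerSeries.derivative K (bernoulliPowerSeries K) * h1

theorem coeff_residue_annihilation (r : ℕ) :
    ((expSeries K - 1) ^ (-(1 : ℤ) - 1) * expSeries K *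
      HahnSeries.single (-((r + 1 : ℕ) : ℤ)) 1).coeff (-1) = annihilationWeight K r := by
  have h0 := bernoulliPowerSeries_mul_exp_sub_one K
  have hE : PowerSeries.exp K - 1 ≠ 0 := by
    intro h
    rw [h, mul_zero] at h0
    exact PowerSeries.X_ne_zero h0.symm
  have hE' : expSeries K - 1 ≠ 0 := by
    rw [expSeries, ← map_one (HahnSeries.ofPowerSeries ℤ K), ← map_sub]
    exact fun h => hE (HahnSeries.ofPowerSeries_injective (by rw [h, map_zero]))
  have hs : (HahnSeries.single (-2 : ℤ) 1 : LaurentSeries K) *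
      HahnSeries.ofPowerSeries ℤ K PowerSeries.X ^ 2 = 1 := by
    rw [HahnSeries.ofPowerSeries_X, pow_two, HahnSeries.single_mul_single,
      HahnSeries.single_mul_single]
    norm_num
  have h1 : (expSeries K - 1) ^ (-(1 : ℤ) - 1) * expSeries K = HahnSeries.single (-2 : ℤ) 1 *
      HahnSeries.ofPowerSeries ℤ K (bernoulliPowerSeries K ^ 2 * PowerSeries.exp K) := by
    rw [show (-(1 : ℤ) - 1) = -((2 : ℕ) : ℤ) by norm_num, zpow_neg, zpow_natCast,
      inv_mul_eq_iff_eq_mul₀ (pow_ne_zero 2 hE')]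
    have h2 : HahnSeries.ofPowerSeries ℤ K PowerSeries.X =
        HahnSeries.ofPowerSeries ℤ K (bernoulliPowerSeries K) * (expSeries K - 1) := by
      rw [← h0, map_mul, map_sub, map_one, expSeries]
    rw [h2] at hs
    rw [map_mul, map_pow]
    change expSeries K = (expSeries K - 1) ^ 2 * (HahnSeries.single (-2 : ℤ) 1 *
      (HahnSeries.ofPowerSeries ℤ K (bernoulliPowerSeries K) ^ 2 * expSeries K))
    linear_combination -(expSeries K) * hs
  have h3 := HahnSeries.coeff_single_mul_add (r := (1 : K)) (a := ((r + 2 : ℕ) : ℤ)) (b := -2)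
    (x := HahnSeries.ofPowerSeries ℤ K (bernoulliPowerSeries K ^ 2 * PowerSeries.exp K))
  rw [h1, HahnSeries.coeff_mul_single, mul_one,
    show (-1 - -((r + 1 : ℕ) : ℤ)) = ((r + 2 : ℕ) : ℤ) + -2 by push_cast; ring, h3, one_mul,
    HahnSeries.ofPowerSeries_apply_coeff, bernoulli_sq_mul_exp, map_sub,
    PowerSeries.coeff_succ_X_mul, PowerSeries.coeff_derivative, bernoulliPowerSeries,
    PowerSeries.coeff_mk, annihilationWeight]
  have hr : (r ! : K) ≠ 0 := Nat.cast_ne_zero.mpr (Nat.factorial_ne_zero r)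
  have hr1 : (r : K) + 1 ≠ 0 := Nat.cast_add_one_ne_zero r
  have hr2 : (r : K) + 2 ≠ 0 := by exact_mod_cast (Nat.succ_ne_zero (r + 1))
  simp only [eq_ratCast, Nat.factorial_succ]
  push_cast
  rw [add_assoc (r : K) 1 1, one_add_one_eq_two]
  field_simp
  ring

theorem pderiv_aeval {K : Type*} [Field K] (p : Polynomial K) (i : ℕ) :
    MvPolynomial.pderiv i (Polynomial.aeval (MvPolynomial.X 0 : Fock K) p) =
      if i = 0 then Polynomial.aeval (MvPolynomial.X 0) (Polynomial.derivative p) else 0 := by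
  classical
  rw [Derivation.map_aeval, MvPolynomial.pderiv_X, Pi.single_apply, smul_eq_mul, mul_ite, mul_one,
    mul_zero]
  simp only [eq_comm]

/-- The modes of `h(z)` on states that involve `h(-1)` only; here `h(0)` is zero. -/
theorem ncoeff_Y_X_zero {K : Type*} [Field K] (b : Fock K)
    (hb : ∀ i ≠ 0, MvPolynomial.pderiv i b = 0) (m : ℤ) :
    ((Y K (MvPolynomial.X 0))[[m]]) b = (if m < 0 then MvPolynomial.X (-m - 1).natAbs * b else 0) +
      if m = 1 then MvPolynomial.pderiv 0 b else 0 := by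
  have hS : (totalDiff K b).support ⊆ {0} := by
    intro i hi
    rw [Finsupp.mem_support_iff, totalDiff_apply] at hi
    exact Finset.mem_singleton.mpr (not_imp_comm.mp (hb i) hi)
  rw [← pow_one (MvPolynomial.X 0), Y_X_zero_pow, ncoeff_toVertexOperator, mode_apply,
    fieldPow_succ, normalOrder_apply 0 _ b _ hS, Finset.sum_singleton, HahnSeries.coeff_add,
    fieldPow_zero_apply, fieldPow_zero_apply, annCoeff, coeff_single_mul',
    HahnSeries.coeff_mul_single, HahnSeries.coeff_single, creation, PowerSeries.coeff_coe]
  congr 1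
  · split_ifs
    · lia
    · rw [zero_mul]
    · simp
    · lia
  · by_cases hm : m = 1
    · subst hm
      simp
    · rw [if_neg (by push_cast; lia), if_neg hm, mul_zero]

/-- The square-bracket mode `h[-r-1]` on polynomials in `h(-1)`. -/
theorem squareMode_aeval (r : ℕ) (p : Polynomial K) :
    squareMode (-((r + 1 : ℕ) : ℤ)) (Polynomial.aeval (MvPolynomial.X 0 : Fock K) p) =
      (∑ i ∈ Finset.range (r + 1), creationWeight K r i •
        (MvPolynomial.X i * Polynomial.aeval (MvPolynomial.X 0) p)) +
      annihilationWeight K r • Polynomial.aeval (MvPolynomial.X 0) (Polynomial.derivative p) := by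
  classical
  set b : Fock K := Polynomial.aeval (MvPolynomial.X 0) p
  have hb : ∀ i ≠ 0, MvPolynomial.pderiv i b = 0 := fun i hi => by
    rw [pderiv_aeval, if_neg hi]
  have hinj : Function.Injective fun i : ℕ => -((i : ℤ) + 1) := fun i j h => by
    simp only at h
    lia
  rw [squareMode, finsum_eq_sum_of_support_subset
    (s := insert 1 ((Finset.range (r + 1)).map ⟨_, hinj⟩)), Finset.sum_insert, Finset.sum_map,
    add_comm]
  · congr 1
    · refine Finset.sum_congr rfl fun i _ => ?_
      rw [Function.Embedding.coeFn_mk, coeff_residue_creation, ncoeff_Y_X_zero b hb,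
        if_pos (by lia), if_neg (by lia), add_zero]
      congr 3
      lia
    · rw [coeff_residue_annihilation, ncoeff_Y_X_zero b hb, if_neg (by lia), if_pos rfl, zero_add,
        pderiv_aeval, if_pos rfl]
  · intro h
    obtain ⟨i, _, hi⟩ := Finset.mem_map.mp h
    simp only [Function.Embedding.coeFn_mk] at hi
    lia
  · intro m hm
    rw [Finset.coe_insert, Set.mem_insert_iff, Finset.mem_coe, Finset.mem_map]
    by_contra h
    rw [not_or] at h
    refine hm ?_
    by_cases h0 : m < 0
    · obtain ⟨i, rfl⟩ : ∃ i : ℕ, m = -((i : ℤ) + 1) := ⟨(-m - 1).natAbs, by lia⟩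
      have hi : ¬ i < r + 1 := fun hi => h.2 ⟨i, Finset.mem_range.mpr hi, rfl⟩
      simp only
      rw [coeff_residue_creation, creationWeight, coeff_exp_sub_one_pow_mul (by lia), zero_smul]
    · simp only
      rw [ncoeff_Y_X_zero b hb, if_neg h0, if_neg h.1, add_zero, smul_zero]

/-! ### Eisenstein series and the recursion -/

theorem sum_creationWeight_contractionCoeff {r d : ℕ} (hr : Even r) (hd : d ≠ 0) :
    ∑ i ∈ Finset.range (r + 1), creationWeight K r i * contractionCoeff K i d =
      2 / (r ! : K) * (d : K) ^ (r + 1) := by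
  have h1 := sum_creationWeight_choose (K := K) r (d - 1)
  have h2 := sum_creationWeight_neg_choose (K := K) r d
  rw [Nat.sub_add_cancel (Nat.pos_of_ne_zero hd)] at h1
  rw [hr.neg_pow] at h2
  have h3 (i : ℕ) : creationWeight K r i * contractionCoeff K i d =
      d * (creationWeight K r i * ((d - 1).choose i : K)) +
        d * (creationWeight K r i * ((-1) ^ i * ((d + i).choose i : K))) := by
    rw [contractionCoeff]
    ring
  simp only [h3, Finset.sum_add_distrib, ← Finset.mul_sum, h1, h2]
  ring

/-- The contractions of the creation part of `h[-r-1]` and its annihilation coefficient add up to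
an Eisenstein series, the latter being the constant term. -/
theorem sum_smul_contraction {r : ℕ} (hr : Even r) :
    ∑ i ∈ Finset.range (r + 1), creationWeight K r i • contraction K i +
      PowerSeries.C (annihilationWeight K r) =
    PowerSeries.C (2 / (r ! : K)) * eisenstein K (r + 2) := by
  ext n
  simp only [map_add, map_sum, map_smul, contraction, lambert, PowerSeries.coeff_mk, smul_eq_mul,
    PowerSeries.coeff_C_mul, eisenstein, PowerSeries.coeff_C, Finset.mul_sum]
  split_ifs with hn
  · have hr0 : (r ! : K) ≠ 0 := Nat.cast_ne_zero.mpr (Nat.factorial_ne_zero r)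
    have hr2 : (r : K) + 2 ≠ 0 := by exact_mod_cast (Nat.succ_ne_zero (r + 1))
    subst hn
    rw [annihilationWeight]
    simp only [Nat.divisors_zero, Finset.sum_empty, Finset.sum_const_zero, zero_add]
    push_cast
    field_simp
  · rw [add_zero, Finset.sum_comm, ArithmeticFunction.sigma_apply, Nat.cast_sum, Finset.mul_sum]
    refine Finset.sum_congr rfl fun d hd => ?_
    have hd0 : d ≠ 0 := fun h => hn (zero_dvd_iff.mp (h ▸ Nat.dvd_of_mem_divisors hd))
    rw [sum_creationWeight_contractionCoeff hr hd0]
    push_cast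
    rfl

/-- The mode `h[-r-1]` acts under the expectation as a multiple of `G_(r+2)` times `d/dh(-1)`. -/
theorem expectation_squareMode {r : ℕ} (hr : Even r) (p : Polynomial K) :
    expectation K (squareMode (-((r + 1 : ℕ) : ℤ))
      (Polynomial.aeval (MvPolynomial.X 0 : Fock K) p)) =
      PowerSeries.C (2 / (r ! : K)) * eisenstein K (r + 2) *
        expectation K (Polynomial.aeval (MvPolynomial.X 0) (Polynomial.derivative p)) := by
  rw [squareMode_aeval, ← sum_smul_contraction hr, map_add, map_sum, map_smul, add_mul,
    Finset.sum_mul, PowerSeries.smul_eq_C_mul]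
  simp only [map_smul, expectation_X_mul_aeval, smul_mul_assoc]

/-- The polynomial `p_t`, of Hermite type, with `h[-1]^t 1 = p_t(h(-1))`. -/
def hermitePoly (K : Type*) [Field K] [CharZero K] : ℕ → Polynomial K
  | 0 => 1
  | t + 1 => Polynomial.X * hermitePoly K t +
      Polynomial.C (annihilationWeight K 0) * Polynomial.derivative (hermitePoly K t)

theorem squareMode_neg_one_aeval (t : ℕ) :
    squareMode (-1) (Polynomial.aeval (MvPolynomial.X 0 : Fock K) (hermitePoly K t)) =
      Polynomial.aeval (MvPolynomial.X 0) (hermitePoly K (t + 1)) := by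
  have h := squareMode_aeval 0 (hermitePoly K t)
  rw [zero_add, Nat.cast_one, Finset.sum_range_one] at h
  have h0 : creationWeight K 0 0 = 1 := by simp [creationWeight]
  rw [h, h0, one_smul, hermitePoly, map_add, Polynomial.aeval_mul, Polynomial.aeval_mul,
    Polynomial.aeval_X, Polynomial.aeval_C, ← Algebra.smul_def]

theorem iterate_squareMode_neg_one (t : ℕ) :
    (squareMode (-1))^[t] (1 : Fock K) =
      Polynomial.aeval (MvPolynomial.X 0) (hermitePoly K t) := by
  induction t with
  | zero => simp [hermitePoly]
  | succ t ih => rw [Function.iterate_succ_apply', ih, squareMode_neg_one_aeval]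

theorem derivative_hermitePoly (t : ℕ) :
    Polynomial.derivative (hermitePoly K (t + 1)) = ((t + 1 : ℕ) : K) • hermitePoly K t := by
  induction t with
  | zero => simp [hermitePoly]
  | succ t ih =>
    rw [hermitePoly, Polynomial.derivative_add, Polynomial.derivative_mul, Polynomial.derivative_X,
      Polynomial.derivative_C_mul, ih, Polynomial.derivative_smul, one_mul]
    conv_rhs => rw [Nat.cast_succ, add_smul, one_smul, hermitePoly]
    rw [smul_add, mul_smul_comm, mul_smul_comm, hermitePoly]
    ring

/-- The even moments of `h[-1]`; at `s = 0` the truncated `2 * s - 1` is `0`, and `0‼ = 1`. -/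
theorem expectation_hermitePoly (s : ℕ) :
    expectation K (Polynomial.aeval (MvPolynomial.X 0) (hermitePoly K (2 * s))) =
      PowerSeries.C ((2 : K) ^ s * ((2 * s - 1)‼ : K)) * eisenstein K 2 ^ s := by
  induction s with
  | zero => simp [hermitePoly, expectation_one]
  | succ s ih =>
    have h := expectation_squareMode (K := K) (r := 0) Even.zero (hermitePoly K (2 * s + 1))
    rw [zero_add, Nat.cast_one, squareMode_neg_one_aeval, derivative_hermitePoly, map_smul,
      map_smul, ih] at h
    have h1 : (2 * (s + 1) - 1)‼ = (2 * s + 1) * (2 * s - 1)‼ := by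
      cases s with
      | zero => rfl
      | succ s => exact Nat.doubleFactorial_add_two (2 * s + 1)
    rw [show 2 * (s + 1) = 2 * s + 1 + 1 by ring, h, show 2 * s + 1 + 1 = 2 * (s + 1) by ring, h1,
      PowerSeries.smul_eq_C_mul]
    simp only [map_mul, map_pow, map_natCast, Nat.factorial_zero, Nat.cast_one, div_one,
      Nat.cast_mul, zero_add]
    ring

end Heisenberg

end

theorem mainTheorem3 {K : Type*} [Field K] [CharZero K] (r t : ℕ) (hr : Odd r) (ht : Odd t) :
    Heisenberg.rescaledCharacter
        (Heisenberg.squareMode (-(r : ℤ)) ((Heisenberg.squareMode (-1))^[t] (1 : Heisenberg.Fock K))) =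
      HahnSeries.ofPowerSeries ℚ K
        (PowerSeries.C ((2 : K) ^ ((t + 1) / 2) * (t : K) * ((t - 2)‼ : K) / ((r - 1)! : K)) *
          Heisenberg.eisenstein K 2 ^ ((t - 1) / 2) * Heisenberg.eisenstein K (r + 1)) := by
  obtain ⟨m, rfl⟩ := hr
  obtain ⟨s, rfl⟩ := ht
  rw [Heisenberg.iterate_squareMode_neg_one, Heisenberg.rescaledCharacter_eq,
    Heisenberg.expectation_squareMode (even_two_mul m), Heisenberg.derivative_hermitePoly,
    map_smul, map_smul, Heisenberg.expectation_hermitePoly, PowerSeries.smul_eq_C_mul,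
    show (2 * s + 1 + 1) / 2 = s + 1 by lia, show (2 * s + 1 - 1) / 2 = s by lia,
    show 2 * s + 1 - 2 = 2 * s - 1 by lia, Nat.add_sub_cancel]
  congr 1
  simp only [map_mul, map_pow, map_natCast, div_eq_mul_inv, pow_succ]
  ring
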